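/- **Definitions.** Let $V$ be a finite set, let $k\in\mathbb{N}$ with $k<|V|$, and let $c:V\times V\to\mathbb{R}_{\ge 0}$ satisfy the triangle inequality. A tour $T$ on $V$ is a closed walk $v_1,\dots,v_r,v_{r+1}=v_1$ that visits every vertex of $V$ at least once; its $k$-hop cost is $c^{(k)}(T)=\sum_{\Delta=1}^{k}\sum_{i=1}^{r}c(v_i,v_{i+\Delta})$ with indices read modulo $r$. For a path $P$ with (pairwise distinct) vertices $v_1,\dots,v_r$ in this order, $c^{(k)}(P)=\sum_{\Delta=1}^{k}\sum_{i=1}^{r}c(v_i,v_{i+\Delta})$, where terms with $i+\Delta>r$ are $0$. A *hierarchically ordered instance* $\mathcal I=(V,L,\mathcal H,D,\prec,c,k)$ of Hop-ATSP consists of $V,c,k$ as above, a depth $L\ge 1$, a total order $\prec$ on $V$, partitions $\mathcal H_1,\dots,\mathcal H_L$ of $V$ and integers $D_1,\dots,D_L$ such that - $\mathcal H_1=\{V\}$, $\mathcal H_L=\{\{v\}:v\in V\}$, and for $1<\ell\le L$ every set of $\mathcal H_\ell$ is contained in a set of $\mathcal H_{\ell-1}$; - every set of every $\mathcal H_\ell$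 consists of vertices that appear consecutively in $\prec$; - $D_\ell\ge 2D_{\ell+1}$ for $1\le\ell<L$; - for $x\ne y$ let $\mathrm{level}(x,y)$ be the largest $\ell\in\{1,\dots,L\}$ such that $x,y$ lie in a common set of $\mathcal H_\ell$; then $c(x,y)\le D_{\mathrm{level}(x,y)}$ if $x\prec y$, and $c(x,y)=D_{\mathrm{level}(x,y)}$ if $y\prec x$. The instance is *degenerate* if there is $H\in\mathcal H_2$ (where $L\ge2$) with $|V\setminus H|\le k/2$, and *non-degenerate* otherwise. A *path-level pair* is a pair $(P,\ell)$ where $\ell\in\{1,\dots,L\}$ and $P$ is a path with vertex set $V(P)$ contained in some $H\in\mathcal H_\ell$ that is monotone, i.e. visits its vertices in increasing order with respect to $\prec$. A *Path Covering solution* for $\mathcal I$ is a finite set $\mathcal P$ of path-level pairs such that (a) every $v\in V$ lies in $V(P)$ for some $(P,\ell)\in\mathcal P$; and (b) for every $\ell\in\{2,\dots,L\}$ and every $H\in\mathcal H_\ell$, either (i) for every $v\in H$ there is $(P,j)\in\mathcal P$ with $j<\ell$ and $v\in V(P)$, or (ii) there is $(P,j)\in\mathcal P$ with $j<\ell$ and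 $|V(P)\cap H|\ge k$. Its weight is $w(\mathcal P)=\sum_{(P,\ell)\in\mathcal P}\bigl(c^{(k)}(P)+k^2 D_\ell\bigr)$. **Lemma.** There is an absolute constant $C>0$ such that for every non-degenerate hierarchically ordered instance $\mathcal I=(V,L,\mathcal H,D,\prec,c,k)$ of Hop-ATSP and every tour $T$ on $V$ there is a Path Covering solution $\mathcal P$ for $\mathcal I$ with $$w(\mathcal P)\ \le\ C\cdot L^3\cdot c^{(k)}(T).$$ -/

import Mathlib

/-- An instance `(V, c, k)` of Hop-ATSP. -/
structure HopATSP (V : Type*) [Fintype V] where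
  /-- the cost function -/
  c : V → V → ℝ
  c_nonneg : ∀ x y, 0 ≤ c x y
  triangle : ∀ x y z, c x z ≤ c x y + c y z
  /-- the hop-distance -/
  k : ℕ
  k_lt_card : k < Fintype.card V

/-- A hierarchical partition `(H 1, …, H L)` of the finite set `V`.
Only the values of `H` at the levels `1, …, L` are meaningful. -/
structure HierarchicalPartition (V : Type*) [Fintype V] [DecidableEq V] where
  /-- the depth -/
  L : ℕ
  one_le_L : 1 ≤ L
  /-- the partition at each level -/
  H : ℕ → Finpartition (Finset.univ : Finset V)
  H_one : (H 1).parts = {Finset.univ}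
  H_L : (H L).parts = Finset.univ.image (fun v : V => ({v} : Finset V))
  refines : ∀ l, 1 < l → l ≤ L → ∀ S ∈ (H l).parts, ∃ S' ∈ (H (l - 1)).parts, S ⊆ S'

namespace HierarchicalPartition

variable {V : Type*} [Fintype V] [DecidableEq V]

/-- `A` is `l`-confined if it is contained in a single element of the partition `H l`. -/
def Confined (𝓗 : HierarchicalPartition V) (A : Finset V) (l : ℕ) : Prop :=
  ∃ S ∈ (𝓗.H l).parts, A ⊆ S

/-- The largest level in `{1, …, L}` at which `A` is confined. -/
noncomputable def level (𝓗 : HierarchicalPartition V) (A : Finset V) : ℕ :=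
  sSup {l : ℕ | 1 ≤ l ∧ l ≤ 𝓗.L ∧ 𝓗.Confined A l}

end HierarchicalPartition

/-- A hierarchically ordered instance of Hop-ATSP on the vertex set `V`. The total order on the
vertices is the given linear order `<` on `V`. Only the values `D 1, …, D L` are meaningful. -/
structure HierOrderedInstance (V : Type*) [Fintype V] [LinearOrder V]
    extends HopATSP V, HierarchicalPartition V where
  /-- the maximum edge cost at each level -/
  D : ℕ → ℤ
  two_mul_D_le : ∀ l, 1 ≤ l → l < L → 2 * D (l + 1) ≤ D l
  /-- every set of every partition consists of consecutive vertices -/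
  compatible : ∀ l, 1 ≤ l → l ≤ L → ∀ S ∈ (H l).parts, (S : Set V).OrdConnected
  cost_forward : ∀ x y, x < y → c x y ≤ D (toHierarchicalPartition.level {x, y})
  cost_backward : ∀ x y, y < x → c x y = D (toHierarchicalPartition.level {x, y})

/-- The list `v₁, …, vᵣ` represents the closed walk `v₁, …, vᵣ, v₁`; this is a tour on `V` if every
vertex is visited at least once. -/
def IsTour {V : Type*} (T : List V) : Prop :=
  T ≠ [] ∧ ∀ v : V, v ∈ T

/-- The `k`-hop cost of the closed walk `v₁, …, vᵣ, v₁` (indices are read cyclically modulo `r`). -/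
noncomputable def tourHopCost {V : Type*} (c : V → V → ℝ) (k : ℕ) (T : List V) : ℝ :=
  ∑ Δ ∈ Finset.Icc 1 k, ∑ i : Fin T.length,
    c (T.get i) (T.get ⟨(i + Δ) % T.length, Nat.mod_lt _ i.pos⟩)

/-- The `k`-hop cost of the path `v₁, …, vᵣ`, where terms with an index beyond `r` count as `0`. -/
noncomputable def pathHopCost {V : Type*} (c : V → V → ℝ) (k : ℕ) (P : List V) : ℝ :=
  ∑ Δ ∈ Finset.Icc 1 k, ∑ i : Fin P.length,
    if h : i + Δ < P.length then c (P.get i) (P.get ⟨i + Δ, h⟩) else 0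

/-- A path: a nonempty sequence of pairwise distinct vertices. -/
def IsPath {V : Type*} (P : List V) : Prop :=
  P ≠ [] ∧ P.Nodup

/-- A monotone path: a path all of whose edges are forward edges. -/
def IsMonotonePath {V : Type*} [LinearOrder V] (P : List V) : Prop :=
  IsPath P ∧ P.IsChain (· < ·)

namespace HierOrderedInstance

variable {V : Type*} [Fintype V] [LinearOrder V]

/-- The instance is degenerate if some `S` in the second partition has `|V \ S| ≤ k / 2`. -/
def Degenerate (I : HierOrderedInstance V) : Prop :=
  2 ≤ I.L ∧ ∃ S ∈ (I.H 2).parts, ((Sᶜ).card : ℝ) ≤ (I.k : ℝ) / 2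

/-- Path-level pairs `(P, l)`. -/
def IsPathLevelPair (I : HierOrderedInstance V) (p : List V × ℕ) : Prop :=
  IsMonotonePath p.1 ∧ (1 ≤ p.2 ∧ p.2 ≤ I.L) ∧ ∃ S ∈ (I.H p.2).parts, p.1.toFinset ⊆ S

/-- Feasible solutions of the Path Covering problem. -/
def IsPathCovering (I : HierOrderedInstance V) (Ps : Finset (List V × ℕ)) : Prop :=
  (∀ p ∈ Ps, I.IsPathLevelPair p) ∧
  (∀ v : V, ∃ p ∈ Ps, v ∈ p.1) ∧
  (∀ l, 2 ≤ l → l ≤ I.L → ∀ S ∈ (I.H l).parts,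
    (∀ v ∈ S, ∃ p ∈ Ps, p.2 < l ∧ v ∈ p.1) ∨
    (∃ p ∈ Ps, p.2 < l ∧ I.k ≤ (p.1.toFinset ∩ S).card))

/-- The weight of a set of path-level pairs. -/
noncomputable def weight (I : HierOrderedInstance V) (Ps : Finset (List V × ℕ)) : ℝ :=
  ∑ p ∈ Ps, (pathHopCost I.c I.k p.1 + (I.k : ℝ) ^ 2 * (I.D p.2 : ℝ))

end HierOrderedInstance

/-!
A tour is turned into monotone paths by cutting it where it runs backwards a lot, and sorting the
pieces.

*Reductions.* Deleting a vertex from a path does not increase its `k`-hop cost, since by the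
triangle inequality the deleted pairs pay for the new ones (`pathHopCost_sublist`). So the tour may
be replaced by a sublist that enumerates the vertices without repetition. Position in this list is
called time. A pair `x, y` is inverted if `x` comes before `y` in time, within a window of length
`W` of order `L ^ (3 / 2) * k`, but `y < x` in the given order; if `i` is the level of the pair,
then the tour pays exactly `D i` for it in its `W`-hop cost. As the `m * k`-hop cost is at most
`m ^ 2` times the `k`-hop cost (`pathHopCost_mul_le`), all inverted pairs together cost `O(L ^ 3)`
times the tour (`TimedHierarchy.inversionCost_le`). This is the main budget.

*Cuts.* Each block of level `j` watches its inverted pairs of level exactly `j`. Whenever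
`L ^ 2 * k ^ 2` of them have accumulated since the last cut of the block or of a block around it, it
is cut, and all blocks inside it with it (`TimedHierarchy.lastCut`). A vertex is assigned to the
last cut before it that concerns it; the vertices of a block of level `j` assigned to one of its
cuts form a segment of level `j`. Segments are further divided into `L` classes according to the
level below which a vertex has few conflicts, that is, inverted partners
(`TimedHierarchy.classLevel`). The sorted classes of segments are the paths.

*Number of paths.* A cut of level `j` needs `L` paths, costing `L * k ^ 2 * D j`, and is paid for by
its own `L ^ 2 * k ^ 2` inverted pairs (`TimedHierarchy.sum_keys_le`). The `L` paths at the start of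
the tour have level `1`; they are paid for by non-degeneracy, which yields `k + 1` vertices with
quadratically many pairs in different blocks of level `2`
(`HierOrderedInstance.sq_mul_levelBound_one_le`).

*Covering.* If some vertex of a block of level `l` lies on a path of level at least `l`, consider
the first cut of level at least `l` inside the block. The segment before this cut contains enough
inverted pairs to have more than `L * k` vertices, all of a segment of smaller level, and one of the
`L` classes gets `k` of them (`TimedHierarchy.exists_long_path_of_isCut`).

*Cost of the paths.* If two vertices with few conflicts are visited in the wrong order at time
distance more than `W`, the tour drops from high to low blocks in between, and the inverted pairs of
the drop force a cut (`TimedHierarchy.pos_le_add_window`). Hence a path ordered by the blocks of its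
class level, and by time inside them, has inversions within the window only, fewer than `k` for each
vertex. So a pair of vertices at distance at most `k` in this order is either inverted, and paid for
by the budget, or at distance at most `3 * k` in time among the vertices of the same path level and
class (`TimedHierarchy.keyDist_pos_le`), where the hop cost is at most nine times that of the tour.
Sorting the vertices inside the blocks of the class level `b` costs `O(k * D b)` for each vertex,
for which its `k` conflicts separated at level `b + 1` pay (`TimedHierarchy.sum_blockDiam_le`).
-/

/-! ### Hop costs of lists and of keyed sets -/

theorem pathHopCost_nil {V : Type*} (c : V → V → ℝ) (k : ℕ) : pathHopCost c k [] = 0 := by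
  simp [pathHopCost]

theorem sum_take_eq {V : Type*} (f : V → ℝ) (l : List V) (k : ℕ) :
    ((l.take k).map f).sum =
      ∑ Δ ∈ Finset.Icc 1 k, if h : Δ - 1 < l.length then f (l.get ⟨Δ - 1, h⟩) else 0 := by
  induction k with
  | zero => simp
  | succ k ih =>
    rw [Finset.sum_Icc_succ_top (by omega), ← ih, List.take_add_one]
    by_cases h : k < l.length <;> simp [h]

/-- The first vertex is paired with the next `k` vertices, which gives a recursion on the list. -/
theorem pathHopCost_cons {V : Type*} (c : V → V → ℝ) (k : ℕ) (x : V) (l : List V) :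
    pathHopCost c k (x :: l) = ((l.take k).map (c x)).sum + pathHopCost c k l := by
  rw [sum_take_eq, pathHopCost, pathHopCost, ← Finset.sum_add_distrib]
  refine Finset.sum_congr rfl fun Δ hΔ => ?_
  have hΔ1 : 1 ≤ Δ := (Finset.mem_Icc.1 hΔ).1
  obtain ⟨Δ, rfl⟩ : ∃ d, Δ = d + 1 := ⟨Δ - 1, by omega⟩
  rw [show (∑ i : Fin (x :: l).length, if h : (i : ℕ) + (Δ + 1) < (x :: l).length then
      c ((x :: l).get i) ((x :: l).get ⟨i + (Δ + 1), h⟩) else 0) =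
      ∑ i : Fin (l.length + 1), if h : (i : ℕ) + (Δ + 1) < l.length + 1 then
      c ((x :: l).get i) ((x :: l).get ⟨i + (Δ + 1), h⟩) else 0 from rfl, Fin.sum_univ_succ]
  congr 1
  · simp
  · refine Finset.sum_congr rfl fun i _ => ?_
    have e : ((i.succ : Fin (l.length + 1)) : ℕ) + (Δ + 1) < l.length + 1 ↔
        (i : ℕ) + (Δ + 1) < l.length := by simp; omega
    by_cases h : (i : ℕ) + (Δ + 1) < l.length
    · rw [dif_pos (e.2 h), dif_pos h]
      congr 1
      simp only [List.get_eq_getElem, Fin.val_succ]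
      rw [← List.getElem_cons_succ x l (i + (Δ + 1)) (by simpa using h)]
      congr 1
      omega
    · rw [dif_neg (mt e.1 h), dif_neg h]

/-- Deleting a vertex from a path creates only pairs at former distance `k + 1` around it, and the
triangle inequality through the deleted vertex pays for each of them with two deleted pairs. -/
theorem pathHopCost_delete {V : Type*} {c : V → V → ℝ}
    (tri : ∀ x y z, c x z ≤ c x y + c y z) (nonneg : ∀ x y, 0 ≤ c x y) (k : ℕ) (A : List V)
    (z : V) (B : List V) :
    pathHopCost c k (A ++ B) + ((B.take (k - A.length)).map (c z)).sum ≤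
      pathHopCost c k (A ++ z :: B) := by
  induction A with
  | nil => simp [pathHopCost_cons, add_comm]
  | cons a A ih =>
    simp only [List.cons_append, pathHopCost_cons, List.length_cons]
    -- `a` reaches the deleted `z` exactly if `A` has fewer than `k` vertices, and then it gains one
    -- partner `b` of `z` in exchange for `z`
    rcases lt_or_ge A.length k with h | h
    · obtain ⟨m, rfl⟩ : ∃ m, k = A.length + m + 1 := ⟨k - A.length - 1, by omega⟩
      have e1 : A.length + m + 1 - A.length = m + 1 := by omega
      have e2 : A.length + m + 1 - (A.length + 1) = m := by omega
      rw [e1] at ih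
      rw [e2, add_assoc A.length, List.take_length_add_append, List.take_length_add_append]
      rw [List.take_add_one] at ih ⊢
      simp only [List.map_append, List.sum_append, List.take_succ_cons, List.map_cons,
        List.sum_cons, ← add_assoc] at ih ⊢
      cases hB : B[m]? with
      | none => rw [hB] at ih; simp at ih ⊢; linarith [nonneg a z]
      | some b => rw [hB] at ih; simp at ih ⊢; linarith [tri a z b]
    · have e1 : k - A.length = 0 := by omega
      have e2 : k - (A.length + 1) = 0 := by omega
      rw [e1] at ih
      rw [e2, List.take_append_of_le_length h, List.take_append_of_le_length h]
      simp at ih ⊢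
      linarith

/-- Vertices are deleted one at a time; the induction carries along the common prefix `A` of the two
paths. -/
theorem pathHopCost_sublist {V : Type*} {c : V → V → ℝ}
    (tri : ∀ x y z, c x z ≤ c x y + c y z) (nonneg : ∀ x y, 0 ≤ c x y) (k : ℕ) {l l' : List V}
    (h : l.Sublist l') : pathHopCost c k l ≤ pathHopCost c k l' := by
  suffices ∀ A : List V, pathHopCost c k (A ++ l) ≤ pathHopCost c k (A ++ l') by
    simpa using this []
  induction h with
  | slnil => simp
  | @cons l₁ l₂ a _ ih =>
    intro A
    have h1 := pathHopCost_delete tri nonneg k A a l₂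
    have h2 : 0 ≤ ((l₂.take (k - A.length)).map (c a)).sum :=
      List.sum_nonneg (by simp only [List.mem_map]; rintro _ ⟨y, _, rfl⟩; exact nonneg _ _)
    linarith [ih A]
  | @cons_cons l₁ l₂ a _ ih =>
    intro A
    simpa using ih (A ++ [a])

theorem sum_Icc_one_eq_sum_range (f : ℕ → ℝ) (n : ℕ) :
    ∑ i ∈ Finset.Icc 1 n, f i = ∑ i ∈ Finset.range n, f (i + 1) := by
  induction n with
  | zero => simp
  | succ n ih => rw [Finset.sum_Icc_succ_top (by omega), Finset.sum_range_succ, ih]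

/-- Pairs at distance at most `m * k` split into at most `m` hops of length at most `k`. -/
theorem sum_Icc_mul_le_of_subadditive {a : ℕ → ℝ} (pos : ∀ p, 0 ≤ a p)
    (sub : ∀ p q, a (p + q) ≤ a p + a q)
    (k m : ℕ) : ∑ Δ ∈ Finset.Icc 1 (m * k), a Δ ≤ (m : ℝ) ^ 2 * ∑ Δ ∈ Finset.Icc 1 k, a Δ := by
  simp only [sum_Icc_one_eq_sum_range]
  -- `a k ≤ a p + a (k - p)`, averaged over `p`
  have hk : (k : ℝ) * a k ≤ 2 * ∑ i ∈ Finset.range k, a (i + 1) := by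
    rcases Nat.eq_zero_or_pos k with rfl | hpos
    · simp
    obtain ⟨r, rfl⟩ : ∃ r, k = r + 1 := ⟨k - 1, by omega⟩
    have h1 : ∑ i ∈ Finset.range r, a (r + 1) ≤
        ∑ i ∈ Finset.range r, (a (i + 1) + a (r - 1 - i + 1)) := by
      refine Finset.sum_le_sum fun i hi => ?_
      have := Finset.mem_range.1 hi
      have h := sub (i + 1) (r - 1 - i + 1)
      rwa [show i + 1 + (r - 1 - i + 1) = r + 1 by omega] at h
    rw [Finset.sum_add_distrib, Finset.sum_range_reflect (fun i => a (i + 1)), Finset.sum_const,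
      Finset.card_range, nsmul_eq_mul] at h1
    have h0 := pos (r + 1)
    rw [Finset.sum_range_succ]
    push_cast
    linarith
  have hr : ∀ m r, a (m * k + r) ≤ m * a k + a r := by
    intro m r
    induction m with
    | zero => simp
    | succ m ih =>
      have := sub k (m * k + r)
      rw [show (m + 1) * k + r = k + (m * k + r) by ring]
      push_cast
      linarith
  induction m with
  | zero => simp
  | succ m ih =>
    rw [add_mul, one_mul, Finset.sum_range_add]
    have h2 : ∑ i ∈ Finset.range k, a (m * k + i + 1) ≤
        ∑ i ∈ Finset.range k, (m * a k + a (i + 1)) :=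
      Finset.sum_le_sum fun i _ => hr m (i + 1)
    rw [Finset.sum_add_distrib, Finset.sum_const, Finset.card_range, nsmul_eq_mul] at h2
    have hm : (0 : ℝ) ≤ m := by positivity
    push_cast
    nlinarith

theorem pathHopCost_mul_le {V : Type*} {c : V → V → ℝ}
    (tri : ∀ x y z, c x z ≤ c x y + c y z) (nonneg : ∀ x y, 0 ≤ c x y) (k m : ℕ) (l : List V) :
    pathHopCost c (m * k) l ≤ (m : ℝ) ^ 2 * pathHopCost c k l := by
  rcases l with _ | ⟨x₀, l'⟩
  · simp [pathHopCost_nil]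
  set l := x₀ :: l' with hl
  set g : ℕ → V := fun i => l.getD i x₀ with hg
  have key : ∀ Δ, (∑ i : Fin l.length,
      if h : i + Δ < l.length then c (l.get i) (l.get ⟨i + Δ, h⟩) else 0) =
      ∑ i ∈ Finset.range (l.length - Δ), c (g i) (g (i + Δ)) := by
    intro Δ
    have e1 : ∀ i : Fin l.length,
        (if h : i + Δ < l.length then c (l.get i) (l.get ⟨i + Δ, h⟩) else 0) =
        (fun i : ℕ => if i + Δ < l.length then c (g i) (g (i + Δ)) else 0) i := by
      intro i
      by_cases h : i + Δ < l.length
      · simp [h, hg]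
      · simp [h]
    rw [Finset.sum_congr rfl fun i _ => e1 i,
      Fin.sum_univ_eq_sum_range (fun i : ℕ => if i + Δ < l.length then c (g i) (g (i + Δ)) else 0),
      ← Finset.sum_filter]
    refine Finset.sum_congr ?_ fun _ _ => rfl
    ext i
    simp only [Finset.mem_filter, Finset.mem_range]
    omega
  simp only [pathHopCost, key]
  refine sum_Icc_mul_le_of_subadditive
    (a := fun Δ => ∑ i ∈ Finset.range (l.length - Δ), c (g i) (g (i + Δ))) 
    (fun _ => Finset.sum_nonneg fun _ _ => nonneg _ _) (fun p q => ?_) k m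
  have h1 : ∑ i ∈ Finset.range (l.length - (p + q)), c (g i) (g (i + (p + q))) ≤
      ∑ i ∈ Finset.range (l.length - (p + q)), c (g i) (g (i + p)) +
      ∑ i ∈ Finset.range (l.length - (p + q)), c (g (p + i)) (g (p + i + q)) := by
    rw [← Finset.sum_add_distrib]
    refine Finset.sum_le_sum fun i _ => ?_
    rw [← add_assoc, add_comm p i]
    exact tri _ _ _
  have h2 : ∑ i ∈ Finset.range (l.length - (p + q)), c (g i) (g (i + p)) ≤
      ∑ i ∈ Finset.range (l.length - p), c (g i) (g (i + p)) :=
    Finset.sum_le_sum_of_subset_of_nonneg (Finset.range_subset_range.2 (by omega))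
      fun _ _ _ => nonneg _ _
  have h3 : ∑ i ∈ Finset.range (l.length - (p + q)), c (g (p + i)) (g (p + i + q)) ≤
      ∑ i ∈ Finset.range (l.length - q), c (g i) (g (i + q)) := by
    rw [← Finset.sum_image (s := Finset.range (l.length - (p + q))) (g := fun i => p + i)
      (f := fun i => c (g i) (g (i + q))) (fun _ _ _ _ h => by simpa using h)]
    refine Finset.sum_le_sum_of_subset_of_nonneg ?_ fun _ _ _ => nonneg _ _
    intro j
    simp only [Finset.mem_image, Finset.mem_range]
    rintro ⟨i, hi, rfl⟩
    omega
  linarith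

/-- If two paths of equal length agree position by position up to a distance `δ`, the `k`-hop cost
of one exceeds that of the other by at most `2 * δ` for each of the pairs. -/
theorem pathHopCost_le_of_forall₂ {V : Type*} {c : V → V → ℝ}
    (tri : ∀ x y z, c x z ≤ c x y + c y z) {δ : ℝ} (hδ : 0 ≤ δ) (k : ℕ) {u w : List V}
    (h : List.Forall₂ (fun x y => c x y ≤ δ ∧ c y x ≤ δ) u w) :
    pathHopCost c k u ≤ pathHopCost c k w + 2 * k * u.length * δ := by
  induction h with
  | nil => simp [pathHopCost_nil]
  | @cons x y u w hxy huw ih =>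
    rw [pathHopCost_cons, pathHopCost_cons]
    have h1 : ((u.take k).map (c x)).sum ≤ ((w.take k).map (c y)).sum + k * (2 * δ) := by
      clear ih
      induction huw generalizing k with
      | nil => simp; positivity
      | @cons a b u w hab _ ih =>
        cases k with
        | zero => simp
        | succ k =>
          have := ih k
          simp only [List.take_succ_cons, List.map_cons, List.sum_cons]
          push_cast
          linarith [tri x y a, tri y b a, hxy.1, hab.2]
    simp only [List.length_cons]
    push_cast
    linarith

theorem pathHopCost_le_mul_length {V : Type*} {c : V → V → ℝ} {δ : ℝ} (hδ : 0 ≤ δ) (k : ℕ)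
    {u : List V} (h : ∀ x ∈ u, ∀ y ∈ u, c x y ≤ δ) :
    pathHopCost c k u ≤ k * u.length * δ := by
  induction u with
  | nil => simp [pathHopCost_nil]
  | cons x u ih =>
    rw [pathHopCost_cons]
    have h1 : ((u.take k).map (c x)).sum ≤ k * δ := by
      have h2 := List.sum_le_card_nsmul ((u.take k).map (c x)) δ (by
        simp only [List.mem_map]
        rintro _ ⟨y, hy, rfl⟩
        exact h x (by simp) y (by simp [List.mem_of_mem_take hy]))
      rw [nsmul_eq_mul, List.length_map, List.length_take] at h2
      refine h2.trans (mul_le_mul_of_nonneg_right ?_ hδ)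
      exact_mod_cast min_le_left _ _
    have h3 := ih fun a ha b hb => h a (by simp [ha]) b (by simp [hb])
    simp only [List.length_cons]
    push_cast
    linarith

/-- Distance from `x` to `y` within `X` when `X` is ordered by the key `κ`. -/
def keyDist {V α : Type*} [LinearOrder α] (κ : V → α) (X : Finset V) (x y : V) : ℕ :=
  (X.filter fun z => κ x < κ z ∧ κ z ≤ κ y).card

/-- The `k`-hop cost of the path that visits `X` in increasing order of the key `κ`. -/
noncomputable def setHopCost {V α : Type*} [LinearOrder α] (c : V → V → ℝ) (k : ℕ) (κ : V → α)
    (X : Finset V) : ℝ :=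
  ∑ x ∈ X, ∑ y ∈ X, if κ x < κ y ∧ keyDist κ X x y ≤ k then c x y else 0

/-- In a list that is sorted by `κ`, the elements of rank at most `k` are the first `k`. -/
theorem sum_ite_card_le_eq_sum_take {V α : Type*} [DecidableEq V] [LinearOrder α] (f : V → ℝ)
    (κ : V → α) (k : ℕ) {l : List V} (hl : l.Pairwise (fun x y => κ x < κ y)) :
    (∑ y ∈ l.toFinset, if (l.toFinset.filter fun z => κ z ≤ κ y).card ≤ k then f y else 0) =
      ((l.take k).map f).sum := by
  induction l generalizing k with
  | nil => simp
  | cons x l ih =>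
    rw [List.pairwise_cons] at hl
    have hx : x ∉ l.toFinset := fun h => lt_irrefl _ (hl.1 x (by simpa using h))
    rw [List.toFinset_cons, Finset.sum_insert hx]
    have e1 : (insert x l.toFinset).filter (fun z => κ z ≤ κ x) = {x} := by
      ext z
      simp only [Finset.mem_filter, Finset.mem_insert, List.mem_toFinset, Finset.mem_singleton]
      constructor
      · rintro ⟨rfl | hz, hzx⟩
        · rfl
        · exact absurd (hl.1 z hz) (not_lt.2 hzx)
      · rintro rfl; simp
    have e2 : ∀ y ∈ l.toFinset, ((insert x l.toFinset).filter (fun z => κ z ≤ κ y)).card =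
        (l.toFinset.filter (fun z => κ z ≤ κ y)).card + 1 := by
      intro y hy
      rw [Finset.filter_insert, if_pos (hl.1 y (by simpa using hy)).le,
        Finset.card_insert_of_notMem (by simp_all)]
    rw [e1, Finset.sum_congr rfl fun y hy => by rw [e2 y hy]]
    cases k with
    | zero => simp
    | succ k => simpa using ih k hl.2

theorem pathHopCost_eq_setHopCost {V α : Type*} [DecidableEq V] [LinearOrder α] (c : V → V → ℝ)
    (k : ℕ) (κ : V → α) {l : List V} (hl : l.Pairwise (fun x y => κ x < κ y)) :
    pathHopCost c k l = setHopCost c k κ l.toFinset := by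
  induction l with
  | nil => simp [pathHopCost_nil, setHopCost]
  | cons x l ih =>
    have hl' := hl
    rw [List.pairwise_cons] at hl
    have hx : x ∉ l.toFinset := fun h => lt_irrefl _ (hl.1 x (by simpa using h))
    have hlt : ∀ y ∈ l.toFinset, κ x < κ y := fun y hy => hl.1 y (by simpa using hy)
    rw [pathHopCost_cons, ih hl.2, List.toFinset_cons]
    conv_rhs => rw [setHopCost, Finset.sum_insert hx]
    rw [
      ← sum_ite_card_le_eq_sum_take (c x) κ k hl.2]
    congr 1
    · rw [Finset.sum_insert hx, if_neg (by simp), zero_add]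
      refine Finset.sum_congr rfl fun y hy => ?_
      have e : keyDist κ (insert x l.toFinset) x y =
          (l.toFinset.filter fun z => κ z ≤ κ y).card := by
        unfold keyDist
        congr 1
        ext z
        simp only [Finset.mem_filter, Finset.mem_insert]
        constructor
        · rintro ⟨rfl | hz, h1, h2⟩
          · exact absurd h1 (lt_irrefl _)
          · exact ⟨hz, h2⟩
        · rintro ⟨hz, h2⟩
          exact ⟨Or.inr hz, hlt z hz, h2⟩
      rw [e]
      simp [hlt y hy]
    · rw [setHopCost]
      refine Finset.sum_congr rfl fun y hy => ?_
      rw [Finset.sum_insert hx, if_neg (fun h => lt_asymm h.1 (hlt y hy)), zero_add]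
      refine Finset.sum_congr rfl fun z hz => ?_
      have e : keyDist κ (insert x l.toFinset) y z = keyDist κ l.toFinset y z := by
        unfold keyDist
        rw [Finset.filter_insert, if_neg (fun h => lt_asymm h.1 (hlt y hy))]
      rw [e]

/-- Every finite set can be listed in increasing order of an injective key. -/
theorem exists_list_pairwise_key_lt {V α : Type*} [DecidableEq V] [LinearOrder α] {κ : V → α}
    (hκ : Function.Injective κ) (X : Finset V) :
    ∃ l : List V, l.toFinset = X ∧ l.Pairwise (fun x y => κ x < κ y) := by
  induction X using Finset.induction_on_max_value κ with
  | empty => exact ⟨[], by simp⟩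
  | insert a s ha hmax ih =>
    obtain ⟨l, rfl, hl⟩ := ih
    refine ⟨l ++ [a], by ext; simp, ?_⟩
    rw [List.pairwise_append]
    refine ⟨hl, by simp, fun x hx y hy => ?_⟩
    obtain rfl : y = a := by simpa using hy
    refine lt_of_le_of_ne (hmax x (by simpa using hx)) fun h => ha ?_
    rw [← hκ h]
    simpa using hx

theorem setHopCost_mul_le {V α : Type*} [LinearOrder α] {c : V → V → ℝ}
    (tri : ∀ x y z, c x z ≤ c x y + c y z) (nonneg : ∀ x y, 0 ≤ c x y) {κ : V → α}
    (hκ : Function.Injective κ) (k m : ℕ) (X : Finset V) :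
    setHopCost c (m * k) κ X ≤ (m : ℝ) ^ 2 * setHopCost c k κ X := by
  classical
  obtain ⟨l, rfl, hl⟩ := exists_list_pairwise_key_lt hκ X
  rw [← pathHopCost_eq_setHopCost c _ κ hl, ← pathHopCost_eq_setHopCost c _ κ hl]
  exact pathHopCost_mul_le tri nonneg k m l

theorem setHopCost_mono {V α : Type*} [LinearOrder α] {c : V → V → ℝ}
    (tri : ∀ x y z, c x z ≤ c x y + c y z) (nonneg : ∀ x y, 0 ≤ c x y) {κ : V → α}
    (hκ : Function.Injective κ) (k : ℕ) {X Y : Finset V} (h : X ⊆ Y) :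
    setHopCost c k κ X ≤ setHopCost c k κ Y := by
  classical
  obtain ⟨l, rfl, hl⟩ := exists_list_pairwise_key_lt hκ Y
  have hX : (l.filter (· ∈ X)).toFinset = X := by
    ext x
    simp only [List.mem_toFinset, List.mem_filter, decide_eq_true_eq]
    exact ⟨And.right, fun hx => ⟨by simpa using h hx, hx⟩⟩
  rw [← pathHopCost_eq_setHopCost c _ κ hl]
  nth_rw 1 [← hX]
  rw [← pathHopCost_eq_setHopCost c _ κ (hl.filter _)]
  exact pathHopCost_sublist tri nonneg k List.filter_sublist

theorem List.forall₂_of_map_eq {α β : Type*} {f : α → β} {u w : List α} {R : α → α → Prop}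
    (h : u.map f = w.map f) (hR : ∀ x y, f x = f y → R x y) : List.Forall₂ R u w := by
  induction u generalizing w with
  | nil =>
    cases w with
    | nil => exact List.Forall₂.nil
    | cons b w => simp at h
  | cons a u ih =>
    cases w with
    | nil => simp at h
    | cons b w =>
      simp only [List.map_cons, List.cons.injEq] at h
      exact List.Forall₂.cons (hR _ _ h.1) (ih h.2)

/-! ### Hop costs of doubled closed walks -/

/-- Each cyclic pair of the closed walk occurs at most twice in the doubled list. -/
theorem pathHopCost_append_self_le {V : Type*} {c : V → V → ℝ} (nonneg : ∀ x y, 0 ≤ c x y)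
    (k : ℕ) (T : List V) : pathHopCost c k (T ++ T) ≤ 2 * tourHopCost c k T := by
  rcases T with _ | ⟨x₀, T'⟩
  · simp [pathHopCost_nil, tourHopCost]
  set T := x₀ :: T' with hT
  have hr : 0 < T.length := by simp [hT]
  rw [pathHopCost, tourHopCost, Finset.mul_sum]
  refine Finset.sum_le_sum fun Δ _ => ?_
  set G : ℕ → ℝ := fun i => c (T.getD (i % T.length) x₀) (T.getD ((i + Δ) % T.length) x₀) with hG
  have h1 : ∀ i : Fin (T ++ T).length, (if h : (i : ℕ) + Δ < (T ++ T).length then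
      c ((T ++ T).get i) ((T ++ T).get ⟨i + Δ, h⟩) else 0) ≤ G i := by
    have hget : ∀ j (h : j < (T ++ T).length), (T ++ T)[j] = T.getD (j % T.length) x₀ := by
      intro j h
      rw [List.length_append] at h
      rw [List.getD_eq_getElem _ _ (Nat.mod_lt _ hr), List.getElem_append]
      split_ifs with hj
      · simp [Nat.mod_eq_of_lt hj]
      · have e : j % T.length = j - T.length := by
          rw [Nat.mod_eq_sub_mod (not_lt.1 hj), Nat.mod_eq_of_lt (by omega)]
        simp [e]
    intro i
    split_ifs with h
    · simp only [List.get_eq_getElem, hget, hG]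
      exact le_rfl
    · exact nonneg _ _
  have h2 : ∀ i : Fin T.length,
      c (T.get i) (T.get ⟨(i + Δ) % T.length, Nat.mod_lt _ i.pos⟩) = G i := by
    intro i
    simp [hG, Nat.mod_eq_of_lt i.2, Nat.mod_lt _ hr]
  refine (Finset.sum_le_sum fun i _ => h1 i).trans ?_
  rw [Finset.sum_congr rfl fun i _ => h2 i, Fin.sum_univ_eq_sum_range G,
    Fin.sum_univ_eq_sum_range G,
    List.length_append, Finset.sum_range_add, two_mul]
  refine add_le_add le_rfl (le_of_eq (Finset.sum_congr rfl fun i _ => ?_))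
  simp [hG, Nat.add_assoc]

/-- In a doubled list of length `k + 1` every ordered pair of vertices occurs at distance at most
`k`. -/
theorem sum_le_pathHopCost_append_self {V : Type*} {c : V → V → ℝ} (nonneg : ∀ x y, 0 ≤ c x y)
    (self : ∀ x, c x x = 0) (k : ℕ) (w : List V) (hw : w.length = k + 1) :
    (w.map fun x => (w.map (c x)).sum).sum ≤ pathHopCost c k (w ++ w) := by
  suffices ∀ suf pre : List V, (pre ++ suf).length = k + 1 →
      (suf.map fun x => ((pre ++ suf).map (c x)).sum).sum ≤
        pathHopCost c k (suf ++ (pre ++ suf)) by simpa using this w [] (by simpa using hw)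
  intro suf
  induction suf with
  | nil =>
    intro pre _
    simp only [List.map_nil, List.sum_nil, List.nil_append]
    exact Finset.sum_nonneg fun _ _ => Finset.sum_nonneg fun _ _ => by
      split_ifs
      · exact nonneg _ _
      · exact le_rfl
  | cons x s ih =>
    intro pre h
    have h1 := ih (pre ++ [x]) (by simpa [Nat.add_assoc, Nat.add_comm] using h)
    have h2 : (s ++ (pre ++ x :: s)).take k = s ++ pre := by
      have : (s ++ pre).length = k := by simp at h ⊢; omega
      rw [← List.append_assoc, List.take_append_of_le_length this.ge,
        List.take_of_length_le this.le]
    rw [List.cons_append, pathHopCost_cons, h2]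
    simp only [List.append_assoc, List.singleton_append] at h1
    simp only [List.map_cons, List.sum_cons, List.map_append, List.sum_append, self] at h1 ⊢
    linarith

/-! ### Drops in a sequence of marks -/

/-- A sequence that contains fewer than `h` marked positions among its first `4 * h` and fewer than
`h` unmarked ones among its last `4 * h` has a window of length `4 * h` whose first half holds `h`
unmarked and whose second half holds `h` marked positions. -/
theorem exists_drop (P : ℕ → Prop) [DecidablePred P] {h a b : ℕ} (hab : a + 4 * h ≤ b)
    (h1 : ((Finset.Ico a (a + 4 * h)).filter P).card < h)
    (h2 : ((Finset.Ico (b - 4 * h) b).filter fun t => ¬ P t).card < h) :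
    ∃ t, a + 2 * h ≤ t ∧ t + 2 * h ≤ b ∧
      h ≤ ((Finset.Ico (t - 2 * h) t).filter fun s => ¬ P s).card ∧
      h ≤ ((Finset.Ico t (t + 2 * h)).filter P).card := by
  have hh : 0 < h := by omega
  have hsplit : ∀ u v, ((Finset.Ico u v).filter P).card +
      ((Finset.Ico u v).filter fun t => ¬ P t).card = v - u := by
    intro u v
    rw [Finset.card_filter_add_card_filter_not, Nat.card_Ico]
  have hex : ∃ t, a ≤ t ∧ h ≤ ((Finset.Ico t (t + 2 * h)).filter P).card := by
    refine ⟨b - 2 * h, by omega, ?_⟩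
    have e := hsplit (b - 2 * h) (b - 2 * h + 2 * h)
    have : ((Finset.Ico (b - 2 * h) (b - 2 * h + 2 * h)).filter fun t => ¬ P t).card ≤
        ((Finset.Ico (b - 4 * h) b).filter fun t => ¬ P t).card :=
      Finset.card_le_card (Finset.filter_subset_filter _
        (Finset.Ico_subset_Ico (by omega) (by omega)))
    omega
  -- the first half-window that holds `h` marked positions: the half-window before it holds fewer
  have hmin := fun m => Nat.find_min hex (m := m)
  obtain ⟨ha, ht⟩ := Nat.find_spec hex
  have htb : Nat.find hex ≤ b - 2 * h := by
    refine Nat.find_min' hex ⟨by omega, ?_⟩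
    have e := hsplit (b - 2 * h) (b - 2 * h + 2 * h)
    have : ((Finset.Ico (b - 2 * h) (b - 2 * h + 2 * h)).filter fun t => ¬ P t).card ≤
        ((Finset.Ico (b - 4 * h) b).filter fun t => ¬ P t).card :=
      Finset.card_le_card (Finset.filter_subset_filter _
        (Finset.Ico_subset_Ico (by omega) (by omega)))
    omega
  set t := Nat.find hex
  have hta : a + 2 * h ≤ t := by
    by_contra hlt
    have : ((Finset.Ico t (t + 2 * h)).filter P).card ≤
        ((Finset.Ico a (a + 4 * h)).filter P).card :=
      Finset.card_le_card (Finset.filter_subset_filter _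
        (Finset.Ico_subset_Ico (by omega) (by omega)))
    omega
  refine ⟨t, hta, by omega, ?_, ht⟩
  have h3 := hmin (t - 2 * h) (by omega)
  have e := hsplit (t - 2 * h) t
  rw [show t - 2 * h + 2 * h = t by omega] at h3
  by_contra h4
  exact h3 ⟨by omega, by omega⟩

/-- A hierarchy of consecutive blocks on `V` together with an enumeration of `V`, the time order.
Blocks of level `i` are encoded by the map `rep i` to the least vertex of the block: `x` and `y` lie
in one block exactly if `rep i x = rep i y`. All data are extended to every natural number as level,
so that the axioms hold without bounds on the level. -/
structure TimedHierarchy (V : Type*) [Fintype V] [LinearOrder V] where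
  /-- the cost function -/
  c : V → V → ℝ
  /-- the hop-distance -/
  k : ℕ
  /-- the depth -/
  L : ℕ
  /-- the least vertex of a block -/
  rep : ℕ → V → V
  /-- the maximum cost within a block of each level -/
  D : ℕ → ℝ
  /-- the time of a vertex -/
  pos : V → ℕ
  k_pos : 1 ≤ k
  L_pos : 1 ≤ L
  c_nonneg : ∀ x y, 0 ≤ c x y
  c_self : ∀ x, c x x = 0
  tri : ∀ x y z, c x z ≤ c x y + c y z
  rep_mono : ∀ i, Monotone (rep i)
  rep_rep : ∀ i v, rep i (rep i v) = rep i v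
  rep_succ : ∀ i x y, rep (i + 1) x = rep (i + 1) y → rep i x = rep i y
  rep_one : ∀ x y, rep 1 x = rep 1 y
  rep_L : ∀ x y, rep L x = rep L y → x = y
  D_nonneg : ∀ i, 0 ≤ D i
  D_anti : Antitone D
  c_le : ∀ i x y, rep i x = rep i y → c x y ≤ D i
  /-- backward edges between different blocks of level `i + 1` are expensive -/
  le_c : ∀ i x y, y < x → rep (i + 1) x ≠ rep (i + 1) y → D i ≤ c x y
  pos_inj : Function.Injective pos
  pos_lt : ∀ v, pos v < Fintype.card V
  pos_surj : ∀ t < Fintype.card V, ∃ v, pos v = t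

namespace TimedHierarchy

variable {V : Type*} [Fintype V] [LinearOrder V] (I : TimedHierarchy V)

theorem rep_eq_of_le {i j : ℕ} (h : i ≤ j) {x y : V} (hxy : I.rep j x = I.rep j y) :
    I.rep i x = I.rep i y := by
  induction h with
  | refl => exact hxy
  | step _ ih => exact ih (I.rep_succ _ _ _ hxy)

theorem lt_of_rep_lt {i : ℕ} {x y : V} (h : I.rep i x < I.rep i y) : x < y :=
  lt_of_not_ge fun h' => not_lt_of_ge (I.rep_mono i h') h

theorem exists_level {b : ℕ} {x y : V} (h : I.rep b x ≠ I.rep b y) :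
    ∃ i, 1 ≤ i ∧ i + 1 ≤ b ∧ I.rep i x = I.rep i y ∧ I.rep (i + 1) x ≠ I.rep (i + 1) y := by
  induction b with
  | zero => exact absurd (I.rep_succ 0 _ _ (I.rep_one x y)) h
  | succ b ih =>
    by_cases hb : I.rep b x = I.rep b y
    · refine ⟨b, ?_, le_rfl, hb, h⟩
      rcases Nat.eq_zero_or_pos b with rfl | hb'
      · exact absurd (I.rep_one x y) h
      · exact hb'
    · obtain ⟨i, h1, h2, h3, h4⟩ := ih hb
      exact ⟨i, h1, by omega, h3, h4⟩

/-! ### Inversions and cuts -/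

/-- The windows in which inverted pairs are looked for have length `4 * scale * k`. A drop within
one window produces at least `(scale * k) ^ 2` inverted pairs, and `L ^ 3 < scale ^ 2` makes this
exceed `L * threshold`, so that some level contributes `threshold` of them. -/
def scale : ℕ := Nat.sqrt (I.L ^ 3) + 1

/-- The largest time distance at which inverted pairs are counted. -/
def window : ℕ := 4 * (I.scale * I.k)

/-- The number of inverted pairs in a segment of a block that triggers a cut. A segment with that
many pairs holds more than `L * k` vertices. -/
def threshold : ℕ := I.L ^ 2 * I.k ^ 2

/-- `x` precedes `y` in the tour by at most the window length, but `y < x`. -/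
def Inverted (x y : V) : Prop :=
  I.pos x < I.pos y ∧ I.pos y ≤ I.pos x + I.window ∧ y < x

instance : DecidableRel I.Inverted := fun _ _ => inferInstanceAs (Decidable (_ ∧ _ ∧ _))

/-- The inverted pairs in the level-`i` block of `v` that are separated at level `i + 1`, visited
between the times `a` and `b`. -/
def inversions (i : ℕ) (v : V) (a b : ℕ) : Finset (V × V) :=
  Finset.univ.filter fun p => I.Inverted p.1 p.2 ∧ I.rep i p.1 = I.rep i v ∧
    I.rep i p.2 = I.rep i v ∧ I.rep (i + 1) p.1 ≠ I.rep (i + 1) p.2 ∧ a ≤ I.pos p.1 ∧ I.pos p.2 ≤ b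

theorem inversions_congr {i : ℕ} {v w : V} (h : I.rep i v = I.rep i w) (a b : ℕ) :
    I.inversions i v a b = I.inversions i w a b := by
  simp only [inversions, h]

/-- The time of the last cut up to time `p` in the level-`i` block of `v` or in a block containing
it, and `0` if there is none. A block of level `j` is cut when its inversions since the last cut
that concerns it reach the threshold; the cut also divides all blocks inside it. -/
def lastCut : ℕ → ℕ → V → ℕ
  | 0, _, _ => 0
  | p + 1, i, v =>
    if ∃ j ∈ Finset.Icc 1 i, I.threshold ≤ (I.inversions j v (lastCut p j v) (p + 1)).card then
      p + 1
    else lastCut p i v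

/-- The level-`j` block of `v` is cut at the given time on account of its own inversions, regardless
of the blocks around it. -/
def IsCut (j : ℕ) (v : V) : ℕ → Prop
  | 0 => False
  | p + 1 => I.threshold ≤ (I.inversions j v (I.lastCut p j v) (p + 1)).card

instance (j : ℕ) (v : V) : DecidablePred (I.IsCut j v)
  | 0 => inferInstanceAs (Decidable False)
  | _ + 1 => inferInstanceAs (Decidable (_ ≤ _))

theorem lastCut_succ (p i : ℕ) (v : V) : I.lastCut (p + 1) i v =
    if ∃ j ∈ Finset.Icc 1 i, I.IsCut j v (p + 1) then p + 1 else I.lastCut p i v := rfl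

theorem lastCut_congr {i : ℕ} {v w : V} (h : I.rep i v = I.rep i w) (p : ℕ) :
    I.lastCut p i v = I.lastCut p i w := by
  induction p generalizing i with
  | zero => rfl
  | succ p ih =>
    rw [lastCut, lastCut, ih h]
    congr 1
    refine propext (exists_congr fun j => and_congr_right fun hj => ?_)
    have hj' := I.rep_eq_of_le (Finset.mem_Icc.1 hj).2 h
    rw [ih hj', I.inversions_congr hj']

theorem isCut_congr {i : ℕ} {v w : V} (h : I.rep i v = I.rep i w) (p : ℕ) :
    I.IsCut i v p ↔ I.IsCut i w p := by
  cases p with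
  | zero => rfl
  | succ p => rw [IsCut, IsCut, I.lastCut_congr h, I.inversions_congr h]

theorem lastCut_le (p i : ℕ) (v : V) : I.lastCut p i v ≤ p := by
  induction p with
  | zero => simp [lastCut]
  | succ p ih => rw [lastCut_succ]; split_ifs <;> omega

theorem lastCut_mono (i : ℕ) (v : V) : Monotone fun p => I.lastCut p i v := by
  refine monotone_nat_of_le_succ fun p => ?_
  have := I.lastCut_le p i v
  simp only [lastCut_succ]
  split_ifs <;> omega

theorem lastCut_mono_level (p : ℕ) (v : V) {i i' : ℕ} (h : i ≤ i') :
    I.lastCut p i v ≤ I.lastCut p i' v := by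
  induction p with
  | zero => simp [lastCut]
  | succ p ih =>
    have := I.lastCut_le p i v
    rw [lastCut_succ, lastCut_succ]
    split_ifs with h1 h2 h2
    · exact le_rfl
    · obtain ⟨j, hj, hc⟩ := h1
      rw [Finset.mem_Icc] at hj
      exact absurd ⟨j, Finset.mem_Icc.2 ⟨hj.1, hj.2.trans h⟩, hc⟩ h2
    · omega
    · exact ih

theorem lastCut_of_isCut {j i : ℕ} {v : V} {p : ℕ} (hj : 1 ≤ j) (hji : j ≤ i)
    (h : I.IsCut j v p) : I.lastCut p i v = p := by
  cases p with
  | zero => exact h.elim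
  | succ p => rw [lastCut_succ, if_pos ⟨j, Finset.mem_Icc.2 ⟨hj, hji⟩, h⟩]

theorem le_lastCut_of_isCut {j i : ℕ} {v : V} {p p' : ℕ} (hj : 1 ≤ j) (hji : j ≤ i) (hp : p ≤ p')
    (h : I.IsCut j v p) : p ≤ I.lastCut p' i v :=
  (I.lastCut_of_isCut hj hji h).symm.le.trans (I.lastCut_mono i v hp)

theorem isCut_of_lastCut_ne_zero {p i : ℕ} {v : V} (h : I.lastCut p i v ≠ 0) :
    ∃ j, 1 ≤ j ∧ j ≤ i ∧ I.IsCut j v (I.lastCut p i v) := by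
  induction p with
  | zero => simp [lastCut] at h
  | succ p ih =>
    rw [lastCut_succ] at h ⊢
    split_ifs at h ⊢ with h1
    · obtain ⟨j, hj, hc⟩ := h1
      exact ⟨j, (Finset.mem_Icc.1 hj).1, (Finset.mem_Icc.1 hj).2, hc⟩
    · exact ih h

/-- A time between the last cut and `p` has the same last cut as `p`. -/
theorem lastCut_eq_of_between {i : ℕ} {v : V} {p p' : ℕ} (h1 : I.lastCut p i v ≤ p')
    (h2 : p' ≤ p) : I.lastCut p' i v = I.lastCut p i v := by
  refine le_antisymm (I.lastCut_mono i v h2) ?_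
  by_cases h0 : I.lastCut p i v = 0
  · omega
  obtain ⟨j, hj1, hj2, hc⟩ := I.isCut_of_lastCut_ne_zero h0
  exact I.le_lastCut_of_isCut hj1 hj2 h1 hc

/-- If no cut of the level-`i` segment falls between `a` and `b`, then none of a coarser segment
does. -/
theorem lastCut_eq_of_le_level {i j : ℕ} {v : V} {a b : ℕ} (hab : a ≤ b) (hji : j ≤ i)
    (h : I.lastCut a i v = I.lastCut b i v) : I.lastCut a j v = I.lastCut b j v := by
  refine I.lastCut_eq_of_between ?_ hab
  refine (I.lastCut_mono_level b v hji).trans ?_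
  rw [← h]
  exact I.lastCut_le _ _ _

/-- As long as no cut occurs, the inversions of each enclosing block stay below the threshold. -/
theorem card_inversions_lt {i j : ℕ} {v : V} {a b : ℕ} (hab : a < b) (hj : 1 ≤ j) (hji : j ≤ i)
    (h : I.lastCut a i v = I.lastCut b i v) :
    (I.inversions j v (I.lastCut a j v) b).card < I.threshold := by
  by_contra hc
  obtain ⟨b, rfl⟩ : ∃ b', b = b' + 1 := ⟨b - 1, by omega⟩
  have h1 : I.lastCut a j v = I.lastCut b j v := by
    refine I.lastCut_eq_of_between ?_ (by omega)
    have e := I.lastCut_eq_of_le_level hab.le hji h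
    have := I.lastCut_le a j v
    have := I.lastCut_mono j v (show b ≤ b + 1 by omega)
    simp only at this
    omega
  have h2 : I.IsCut j v (b + 1) := by
    rw [IsCut, ← h1]; exact not_lt.1 hc
  have h3 := I.lastCut_of_isCut hj hji h2
  have := I.lastCut_le a i v
  omega

/-- The vertices that form an inverted pair with `v` within the window, not both in one level-`i`
block. -/
def conflicts (i : ℕ) (v : V) : Finset V :=
  Finset.univ.filter fun w => (I.Inverted v w ∨ I.Inverted w v) ∧ I.rep i v ≠ I.rep i w

theorem conflicts_mono {i j : ℕ} (h : i ≤ j) (v : V) : I.conflicts i v ⊆ I.conflicts j v := by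
  intro w
  simp only [conflicts, Finset.mem_filter, Finset.mem_univ, true_and]
  exact fun ⟨h1, h2⟩ => ⟨h1, fun h3 => h2 (I.rep_eq_of_le h h3)⟩

theorem exists_classLevel (v : V) : ∃ b, 1 ≤ b ∧ (I.L ≤ b ∨ I.k ≤ (I.conflicts (b + 1) v).card) :=
  ⟨I.L, I.L_pos, Or.inl le_rfl⟩

/-- The least `b` such that `v` has `k` conflicts separated at level `b + 1`, capped at `L`. Thus
`v` has fewer than `k` conflicts separated at level `classLevel v`. If `classLevel v < L`, the `k`
conflicts separated one level further down pay for moving `v` around inside its block of level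
`classLevel v`. -/
def classLevel (v : V) : ℕ := Nat.find (I.exists_classLevel v)

theorem one_le_classLevel (v : V) : 1 ≤ I.classLevel v := (Nat.find_spec (I.exists_classLevel v)).1

theorem classLevel_le (v : V) : I.classLevel v ≤ I.L :=
  Nat.find_min' _ ⟨I.L_pos, Or.inl le_rfl⟩

theorem le_card_conflicts {v : V} (h : I.classLevel v < I.L) :
    I.k ≤ (I.conflicts (I.classLevel v + 1) v).card :=
  (Nat.find_spec (I.exists_classLevel v)).2.resolve_left (not_le.2 h)

theorem card_conflicts_lt (v : V) : (I.conflicts (I.classLevel v) v).card < I.k := by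
  have h1 := I.one_le_classLevel v
  by_contra hc
  rcases h1.eq_or_lt with h | h
  · have : I.conflicts (I.classLevel v) v = ∅ := by
      rw [← h]
      exact Finset.filter_eq_empty_iff.2 fun w _ hw => hw.2 (I.rep_one _ _)
    rw [this, Finset.card_empty] at hc
    exact hc I.k_pos
  · obtain ⟨b, hb⟩ : ∃ b, I.classLevel v = b + 1 := ⟨I.classLevel v - 1, by omega⟩
    refine Nat.find_min (I.exists_classLevel v) (m := b) (by change b < I.classLevel v; omega)
      ⟨by omega, Or.inr ?_⟩
    rw [← hb]
    omega

/-- The last cut before `v` in any of the blocks that contain `v`, or `0`. -/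
def start (v : V) : ℕ := I.lastCut (I.pos v) I.L v

theorem exists_pathLevel (v : V) : ∃ i, 1 ≤ i ∧ I.lastCut (I.pos v) i v = I.start v :=
  ⟨I.L, I.L_pos, rfl⟩

/-- The level of the path through `v`: the coarsest level at which the segment of `v` begins at
`start v`. -/
def pathLevel (v : V) : ℕ := Nat.find (I.exists_pathLevel v)

theorem one_le_pathLevel (v : V) : 1 ≤ I.pathLevel v := (Nat.find_spec (I.exists_pathLevel v)).1

theorem pathLevel_le (v : V) : I.pathLevel v ≤ I.L := Nat.find_min' _ ⟨I.L_pos, rfl⟩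

theorem lastCut_pathLevel (v : V) : I.lastCut (I.pos v) (I.pathLevel v) v = I.start v :=
  (Nat.find_spec (I.exists_pathLevel v)).2

theorem lastCut_eq_start {v : V} {i : ℕ} (h1 : I.pathLevel v ≤ i) (h2 : i ≤ I.L) :
    I.lastCut (I.pos v) i v = I.start v :=
  le_antisymm (I.lastCut_mono_level _ _ h2)
    (I.lastCut_pathLevel v ▸ I.lastCut_mono_level _ _ h1)

/-- A path that does not begin at time `0` begins at a cut made by its own block. -/
theorem isCut_start {v : V} (h : I.start v ≠ 0) : I.IsCut (I.pathLevel v) v (I.start v) := by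
  have h0 := h
  rw [← I.lastCut_pathLevel] at h
  obtain ⟨j, hj1, hj2, hc⟩ := I.isCut_of_lastCut_ne_zero h
  rw [I.lastCut_pathLevel] at hc
  have hle : I.start v ≤ I.pos v := I.lastCut_le _ _ _
  have h1 := I.le_lastCut_of_isCut hj1 le_rfl hle hc
  have h2 : I.lastCut (I.pos v) j v ≤ I.start v :=
    (I.lastCut_mono_level _ _ hj2).trans (I.lastCut_pathLevel v).le
  have h3 : I.pathLevel v ≤ j := Nat.find_min' _ ⟨hj1, le_antisymm h2 h1⟩
  rwa [le_antisymm hj2 h3] at hc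

theorem pathLevel_eq_one {v : V} (h : I.start v = 0) : I.pathLevel v = 1 := by
  refine le_antisymm (Nat.find_min' _ ⟨le_rfl, ?_⟩) (I.one_le_pathLevel v)
  have := I.lastCut_mono_level (I.pos v) v I.L_pos
  change _ ≤ I.start v at this
  omega

/-- The key of the path through `v`: its level, the class level of its vertices, the least vertex of
its block, and the time at which its segment starts. Vertices with the same key lie on the same
path. -/
def key (v : V) : ℕ × ℕ × V × ℕ :=
  (I.pathLevel v, I.classLevel v, I.rep (I.pathLevel v) v, I.start v)

/-! ### Vertices of one path are nearly sorted by time -/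

theorem rep_lt_rep {i : ℕ} {x y : V} (h : x < y) (hne : I.rep i x ≠ I.rep i y) :
    I.rep i x < I.rep i y := lt_of_le_of_ne (I.rep_mono i h.le) hne

theorem pow_three_lt_scale_sq : I.L ^ 3 < I.scale * I.scale := Nat.lt_succ_sqrt _

/-- A long-range inverted pair `x, y`, both with few conflicts, forces a cut between them. Call a
vertex low if its block of level `i + 1` is at most that of `y`. Shortly after `x` there are few low
vertices, shortly before `y` few others, so between them the tour drops from high to low. The many
inverted pairs of this drop all lie in blocks of level at most `i` around `x` and `y`, and some
level has enough of them for a cut. -/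
theorem pos_le_add_window {x y : V} {i : ℕ} (hxy : I.pos x < I.pos y)
    (hlt : y < x) (he : I.rep i x = I.rep i y) (hne : I.rep (i + 1) x ≠ I.rep (i + 1) y)
    (hx : (I.conflicts (i + 1) x).card < I.k) (hy : (I.conflicts (i + 1) y).card < I.k)
    (hl : I.lastCut (I.pos x) i x = I.lastCut (I.pos y) i x) :
    I.pos y ≤ I.pos x + I.window := by
  classical
  by_contra hfar
  set h := I.scale * I.k with hh
  have hW : I.window = 4 * h := rfl
  have hk : I.k ≤ h := Nat.le_mul_of_pos_left _ (Nat.succ_pos _)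
  have hyx : I.rep (i + 1) y < I.rep (i + 1) x := I.rep_lt_rep hlt hne.symm
  have hiL : i < I.L := by
    by_contra hc
    exact hlt.ne' (I.rep_L _ _ (I.rep_eq_of_le (not_lt.1 hc) he))
  obtain ⟨t, ht1, ht2, hA, hB⟩ := exists_drop
    (fun t => ∃ v, I.pos v = t ∧ I.rep (i + 1) v ≤ I.rep (i + 1) y)
    (h := h) (a := I.pos x + 1) (b := I.pos y) (by omega)
    (by
      refine lt_of_le_of_lt ?_ (hx.trans_le hk)
      refine le_trans (Finset.card_le_card ?_) (Finset.card_image_le (f := I.pos))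
      intro t ht
      simp only [Finset.mem_filter, Finset.mem_Ico] at ht
      obtain ⟨ht, v, rfl, hv⟩ := ht
      have hvx := hv.trans_lt hyx
      exact Finset.mem_image.2 ⟨v, Finset.mem_filter.2 ⟨Finset.mem_univ _,
        Or.inl ⟨by omega, by omega, I.lt_of_rep_lt hvx⟩, hvx.ne'⟩, rfl⟩)
    (by
      refine lt_of_le_of_lt ?_ (hy.trans_le hk)
      refine le_trans (Finset.card_le_card ?_) (Finset.card_image_le (f := I.pos))
      intro t ht
      simp only [Finset.mem_filter, Finset.mem_Ico] at ht
      obtain ⟨ht, hP⟩ := ht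
      obtain ⟨v, rfl⟩ := I.pos_surj t (ht.2.trans (I.pos_lt y))
      have hv : I.rep (i + 1) y < I.rep (i + 1) v := not_le.1 fun hv => hP ⟨v, rfl, hv⟩
      exact Finset.mem_image.2 ⟨v, Finset.mem_filter.2 ⟨Finset.mem_univ _,
        Or.inr ⟨by omega, by omega, I.lt_of_rep_lt hv⟩, hv.ne⟩, rfl⟩)
  set A := Finset.univ.filter fun v => (t - 2 * h ≤ I.pos v ∧ I.pos v < t) ∧
    I.rep (i + 1) y < I.rep (i + 1) v
  set B := Finset.univ.filter fun v => (t ≤ I.pos v ∧ I.pos v < t + 2 * h) ∧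
    I.rep (i + 1) v ≤ I.rep (i + 1) y
  have hA' : h ≤ A.card := by
    refine hA.trans (le_trans (Finset.card_le_card ?_) (Finset.card_image_le (f := I.pos)))
    intro s hs
    simp only [Finset.mem_filter, Finset.mem_Ico] at hs
    obtain ⟨hs, hP⟩ := hs
    obtain ⟨v, rfl⟩ := I.pos_surj s (by have := I.pos_lt y; omega)
    exact Finset.mem_image.2 ⟨v, Finset.mem_filter.2 ⟨Finset.mem_univ _, hs,
      not_le.1 fun hv => hP ⟨v, rfl, hv⟩⟩, rfl⟩
  have hB' : h ≤ B.card := by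
    refine hB.trans (le_trans (Finset.card_le_card ?_) (Finset.card_image_le (f := I.pos)))
    intro s hs
    simp only [Finset.mem_filter, Finset.mem_Ico] at hs
    obtain ⟨hs, v, rfl, hv⟩ := hs
    exact Finset.mem_image.2 ⟨v, Finset.mem_filter.2 ⟨Finset.mem_univ _, hs, hv⟩, rfl⟩
  -- a high and a low vertex straddle `y`, so the block of `y` at their common level contains both
  have hsub : A ×ˢ B ⊆ (Finset.Icc 1 i).biUnion fun j =>
      I.inversions j x (I.lastCut (I.pos x) j x) (I.pos y) := by
    rintro ⟨z, z'⟩ hz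
    simp only [A, B, Finset.mem_product, Finset.mem_filter, Finset.mem_univ, true_and] at hz
    obtain ⟨⟨hz1, hz2⟩, hz1', hz2'⟩ := hz
    have hzz := hz2'.trans_lt hz2
    obtain ⟨j, hj1, hj2, hj3, hj4⟩ := I.exists_level hzz.ne'
    have hji : j ≤ i := by omega
    have hz'y : I.rep j z' ≤ I.rep j y := by
      rcases hz2'.eq_or_lt with h | h
      · exact (I.rep_eq_of_le (by omega) h).le
      · exact I.rep_mono j (I.lt_of_rep_lt h).le
    have hyz : I.rep j y ≤ I.rep j z := I.rep_mono j (I.lt_of_rep_lt hz2).le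
    have hjx : I.rep j x = I.rep j y := I.rep_eq_of_le hji he
    have hzy : I.rep j z = I.rep j y := le_antisymm (hj3 ▸ hz'y) hyz
    have := I.lastCut_le (I.pos x) j x
    exact Finset.mem_biUnion.2 ⟨j, Finset.mem_Icc.2 ⟨hj1, hji⟩, Finset.mem_filter.2
      ⟨Finset.mem_univ _, ⟨by dsimp only; omega, by dsimp only; omega, I.lt_of_rep_lt hzz⟩,
        hzy.trans hjx.symm, hj3 ▸ hzy.trans hjx.symm, hj4, by dsimp only; omega,
        by dsimp only; omega⟩⟩
  have h1 := (Finset.card_le_card hsub).trans Finset.card_biUnion_le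
  have h2 : ∑ j ∈ Finset.Icc 1 i,
      (I.inversions j x (I.lastCut (I.pos x) j x) (I.pos y)).card ≤ i * I.threshold := by
    refine (Finset.sum_le_card_nsmul _ _ I.threshold fun j hj => ?_).trans (by simp)
    rw [Finset.mem_Icc] at hj
    exact (I.card_inversions_lt hxy hj.1 hj.2 hl).le
  have h3 : h * h ≤ A.card * B.card := Nat.mul_le_mul hA' hB'
  rw [Finset.card_product] at h1
  have h4 : i * I.threshold ≤ I.L * I.threshold := Nat.mul_le_mul_right _ hiL.le
  have h5 : I.L * I.threshold = I.L ^ 3 * I.k ^ 2 := by unfold threshold; ring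
  have h6 : h * h = (I.scale * I.scale) * I.k ^ 2 := by rw [hh]; ring
  have h7 : I.L ^ 3 * I.k ^ 2 < (I.scale * I.scale) * I.k ^ 2 :=
    Nat.mul_lt_mul_of_pos_right I.pow_three_lt_scale_sq (pow_pos I.k_pos 2)
  omega

/-- No cut that concerns the common block separates two vertices of one path. -/
theorem lastCut_pos_eq_of_key_eq {x z : V} (hk : I.key x = I.key z) {i : ℕ}
    (h : I.rep i x = I.rep i z) (hi : I.pathLevel x ≤ i) (hiL : i ≤ I.L) :
    I.lastCut (I.pos x) i x = I.lastCut (I.pos z) i x := by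
  simp only [key, Prod.mk.injEq] at hk
  rw [I.lastCut_eq_start hi hiL, hk.2.2.2, I.lastCut_congr h,
    I.lastCut_eq_start (hk.1 ▸ hi) hiL]

theorem level_lt_L {i : ℕ} {x y : V} (h : I.rep i x = I.rep i y)
    (hne : I.rep (i + 1) x ≠ I.rep (i + 1) y) : i < I.L := by
  by_contra hc
  have := I.rep_L _ _ (I.rep_eq_of_le (not_lt.1 hc) h)
  exact hne (by rw [this])

/-- Two vertices of one path that the tour visits in the wrong order, and that a block order at
their class level separates, are visited within one window. -/
theorem inverted_of_key_eq {x z : V} (hk : I.key x = I.key z) (hp : I.pos x < I.pos z)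
    (hr : I.rep (I.classLevel x) z < I.rep (I.classLevel x) x) : I.Inverted x z := by
  have hlt := I.lt_of_rep_lt hr
  refine ⟨hp, ?_, hlt⟩
  obtain ⟨i, hi1, hi2, hi3, hi4⟩ := I.exists_level hr.ne'
  have hk' := hk
  simp only [key, Prod.mk.injEq] at hk'
  have hji : I.pathLevel x ≤ i := by
    by_contra hc
    refine hi4 (I.rep_eq_of_le (show i + 1 ≤ I.pathLevel x by omega) ?_)
    rw [hk'.2.2.1, hk'.1]
  have hiL := I.level_lt_L hi3 hi4
  refine I.pos_le_add_window hp hlt hi3 hi4 ?_ ?_ (I.lastCut_pos_eq_of_key_eq hk hi3 hji hiL.le)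
  · exact (Finset.card_le_card (I.conflicts_mono hi2 x)).trans_lt (I.card_conflicts_lt x)
  · rw [hk'.2.1] at hi2
    exact (Finset.card_le_card (I.conflicts_mono hi2 z)).trans_lt (I.card_conflicts_lt z)

/-- The vertices that lie on paths of level `j` and have class level `b`. -/
def levelClass (j b : ℕ) : Finset V :=
  Finset.univ.filter fun v => I.pathLevel v = j ∧ I.classLevel v = b

/-- The vertices on the path of `x`. -/
def pathSet (x : V) : Finset V := Finset.univ.filter fun v => I.key v = I.key x

/-- Order by blocks of level `b`, and by time within each block. -/
def blockKey (b : ℕ) (v : V) : V ×ₗ ℕ := toLex (I.rep b v, I.pos v)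

theorem blockKey_lt {b : ℕ} {x y : V} : I.blockKey b x < I.blockKey b y ↔
    I.rep b x < I.rep b y ∨ I.rep b x = I.rep b y ∧ I.pos x < I.pos y := by
  simp [blockKey, Prod.Lex.toLex_lt_toLex]

theorem blockKey_injective (b : ℕ) : Function.Injective (I.blockKey b) := fun x y h => by
  have : (I.rep b x, I.pos x) = (I.rep b y, I.pos y) := toLex.injective h
  exact I.pos_inj (Prod.ext_iff.1 this).2

/-- The step from the block order of a path back to the order of time. A vertex that the tour visits
between `x` and `y`, itself on a path of the same level and class, lies between `x` and `y` in the
block order of their path unless it conflicts with `x` or `y`; and either has fewer than `k`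
conflicts. -/
theorem keyDist_pos_le {x y : V} (hk : I.key x = I.key y) (hjb : I.pathLevel x < I.classLevel x)
    (hp : I.pos x < I.pos y)
    (hd : keyDist (I.blockKey (I.classLevel x)) (I.pathSet x) x y ≤ I.k) :
    keyDist I.pos (I.levelClass (I.pathLevel x) (I.classLevel x)) x y ≤ 3 * I.k := by
  have hk' := hk
  simp only [key, Prod.mk.injEq] at hk'
  obtain ⟨kj, kb, kr, ks⟩ := hk'
  have hsub : (I.levelClass (I.pathLevel x) (I.classLevel x)).filter
      (fun z => I.pos x < I.pos z ∧ I.pos z ≤ I.pos y) ⊆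
      ((I.pathSet x).filter fun z => I.blockKey (I.classLevel x) x < I.blockKey (I.classLevel x) z ∧
        I.blockKey (I.classLevel x) z ≤ I.blockKey (I.classLevel x) y) ∪
      (I.conflicts (I.classLevel x) x ∪ I.conflicts (I.classLevel y) y) := by
    intro z hz
    simp only [levelClass, Finset.mem_filter, Finset.mem_univ, true_and] at hz
    obtain ⟨⟨zj, zb⟩, hxz, hzy⟩ := hz
    by_contra hnot
    simp only [Finset.mem_union, not_or] at hnot
    obtain ⟨hn1, hn2, hn3⟩ := hnot
    have hzy' : z ≠ y → I.pos z < I.pos y := fun hne =>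
      lt_of_le_of_ne hzy fun h => hne (I.pos_inj h)
    -- inverted pairs are conflicts
    have n2 : I.rep (I.classLevel x) z ≠ I.rep (I.classLevel x) x → ¬ I.Inverted x z :=
      fun hne hinv => hn2 (Finset.mem_filter.2 ⟨Finset.mem_univ _, Or.inl hinv, hne.symm⟩)
    have n3 : I.rep (I.classLevel x) z ≠ I.rep (I.classLevel x) y → ¬ I.Inverted z y :=
      fun hne hinv => hn3 (Finset.mem_filter.2 ⟨Finset.mem_univ _, Or.inr hinv, kb ▸ hne.symm⟩)
    by_cases hkz : I.key z = I.key x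
    · have hin : z ∈ I.pathSet x := Finset.mem_filter.2 ⟨Finset.mem_univ _, hkz⟩
      have hxz' : I.blockKey (I.classLevel x) x < I.blockKey (I.classLevel x) z := by
        rw [blockKey_lt]
        rcases lt_trichotomy (I.rep (I.classLevel x) x) (I.rep (I.classLevel x) z) with h | h | h
        · exact Or.inl h
        · exact Or.inr ⟨h, hxz⟩
        · exact absurd (I.inverted_of_key_eq hkz.symm hxz h) (n2 h.ne)
      have hzy'' : I.blockKey (I.classLevel x) z ≤ I.blockKey (I.classLevel x) y := by
        by_cases hzy0 : z = y
        · rw [hzy0]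
        refine le_of_lt ?_
        rw [blockKey_lt]
        rcases lt_trichotomy (I.rep (I.classLevel x) z) (I.rep (I.classLevel x) y) with h | h | h
        · exact Or.inl h
        · exact Or.inr ⟨h, hzy' hzy0⟩
        · exact absurd (I.inverted_of_key_eq (hkz.trans hk) (hzy' hzy0) (zb.symm ▸ h)) (n3 h.ne')
      exact hn1 (Finset.mem_filter.2 ⟨hin, hxz', hzy''⟩)
    · -- off the path of `x`, the vertex `z` lies in another block of level `pathLevel x`
      have hxyj : I.rep (I.pathLevel x) x = I.rep (I.pathLevel x) y := by rw [kr, kj]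
      have hzne : z ≠ y := fun h => hkz (h ▸ hk.symm)
      have hlast : I.lastCut (I.pos x) (I.pathLevel x) x = I.lastCut (I.pos y) (I.pathLevel x) x :=
        I.lastCut_pos_eq_of_key_eq hk hxyj le_rfl (I.pathLevel_le x)
      -- no cut separates the three vertices in a common segment of level at most `pathLevel x`
      have hmid : ∀ i ≤ I.pathLevel x, I.lastCut (I.pos x) i x = I.lastCut (I.pos z) i x ∧
          I.lastCut (I.pos z) i x = I.lastCut (I.pos y) i x := by
        intro i hi
        have h1 := I.lastCut_eq_of_le_level hp.le hi hlast
        have h2 := I.lastCut_mono i x hxz.le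
        have h3 := I.lastCut_mono i x hzy
        simp only at h2 h3
        omega
      have hzj : I.rep (I.pathLevel x) z ≠ I.rep (I.pathLevel x) x := by
        intro h
        refine hkz ?_
        have h1 := (hmid _ le_rfl).1
        rw [I.lastCut_pathLevel, ← I.lastCut_congr h, ← zj, I.lastCut_pathLevel] at h1
        simp only [key, zj, zb, h, h1]
      have hzb : I.rep (I.classLevel x) z ≠ I.rep (I.classLevel x) x :=
        fun h => hzj (I.rep_eq_of_le hjb.le h)
      have hcard : ∀ {i : ℕ}, i + 1 ≤ I.pathLevel x → ∀ v, I.classLevel v = I.classLevel x →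
          (I.conflicts (i + 1) v).card < I.k := fun hi v hv =>
        (Finset.card_le_card (I.conflicts_mono (by omega) v)).trans_lt (I.card_conflicts_lt v)
      rcases lt_or_gt_of_ne hzj with h | h
      · obtain ⟨i, hi1, hi2, hi3, hi4⟩ := I.exists_level h.ne'
        have hlt := I.lt_of_rep_lt h
        exact n2 hzb ⟨hxz, I.pos_le_add_window hxz hlt hi3 hi4 (hcard hi2 _ rfl) (hcard hi2 _ zb)
          (hmid i (by omega)).1, hlt⟩
      · rw [hxyj] at h hzj
        obtain ⟨i, hi1, hi2, hi3, hi4⟩ := I.exists_level h.ne'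
        have hlt := I.lt_of_rep_lt h
        have hzy3 := hzy' hzne
        have hxi : I.rep i z = I.rep i x :=
          hi3.trans (I.rep_eq_of_le (by omega) hxyj.symm)
        refine n3 (fun h => hzj (I.rep_eq_of_le hjb.le h)) ⟨hzy3, I.pos_le_add_window hzy3 hlt hi3
          hi4 (hcard hi2 _ zb) (hcard hi2 _ kb.symm) ?_, hlt⟩
        rw [I.lastCut_congr hxi, I.lastCut_congr hxi]
        exact (hmid i (by omega)).2
  have h1 := (Finset.card_le_card hsub).trans (Finset.card_union_le _ _)
  have h2 := Finset.card_union_le (I.conflicts (I.classLevel x) x) (I.conflicts (I.classLevel y) y)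
  have h3 := I.card_conflicts_lt x
  have h4 := I.card_conflicts_lt y
  unfold keyDist at hd ⊢
  omega

/-! ### Paths of small level in a large block -/

theorem pathLevel_eq_of_forall {u : V} {i₀ : ℕ} {P : ℕ → Prop} (h1 : 1 ≤ i₀) (h2 : P i₀)
    (h3 : ∀ i, 1 ≤ i → P i → i₀ ≤ i)
    (h : ∀ i ≤ i₀, 1 ≤ i → (I.lastCut (I.pos u) i u = I.start u ↔ P i)) : I.pathLevel u = i₀ := by
  refine le_antisymm (Nat.find_min' _ ⟨h1, (h i₀ le_rfl h1).2 h2⟩) ?_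
  by_contra hc
  have hc' : I.pathLevel u ≤ i₀ := (not_le.1 hc).le
  exact hc (h3 _ (I.one_le_pathLevel u)
    ((h _ hc' (I.one_le_pathLevel u)).1 (I.lastCut_pathLevel u)))

/-- A block of level `l` in which some cut of level at least `l` is made contains `k` vertices of a
single path of smaller level: the segment that ends at the first such cut is long, and apart from
its last vertex it lies on `L` paths, one for each class. -/
theorem exists_long_path_of_isCut {l : ℕ} (hl : 2 ≤ l) {v₀ w : V} {j q : ℕ} (hlj : l ≤ j)
    (hjL : j ≤ I.L) (hw : I.rep l w = I.rep l v₀) (hcut : I.IsCut j w q)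
    (hmin : ∀ q' < q, ∀ j' u, l ≤ j' → j' ≤ I.L → I.rep l u = I.rep l v₀ → ¬ I.IsCut j' u q') :
    ∃ x, I.pathLevel x < l ∧
      I.k ≤ ((I.pathSet x).filter fun u => I.rep l u = I.rep l v₀).card := by
  classical
  obtain _ | p := q
  · exact hcut.elim
  set q₀ := I.lastCut p j w with hq₀
  have hlow : ∀ u, I.rep l u = I.rep l v₀ → ∀ j' q', 1 ≤ j' → j' ≤ I.L → q' ≤ p →
      I.IsCut j' u q' → j' < l := by
    intro u hu j' q' _ h2 h3 h4
    by_contra hc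
    exact hmin q' (by omega) j' u (not_lt.1 hc) h2 hu h4
  have hq₀p : q₀ ≤ p := I.lastCut_le _ _ _
  -- `i₀` is the level of the cut at `q₀`; it is less than `l` because `p + 1` is the first cut of
  -- level at least `l`
  have hex : ∃ i, 1 ≤ i ∧ I.lastCut p i w = q₀ := ⟨j, by omega, rfl⟩
  obtain ⟨hi1, hi2⟩ := Nat.find_spec hex
  have hi3 : ∀ i, 1 ≤ i → I.lastCut p i w = q₀ → Nat.find hex ≤ i :=
    fun i h1 h2 => Nat.find_min' hex ⟨h1, h2⟩
  set i₀ := Nat.find hex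
  have hi₀l : i₀ < l := by
    have : i₀ ≤ l - 1 := by
      refine hi3 _ (by omega) (le_antisymm (I.lastCut_mono_level _ _ (by omega)) ?_)
      by_cases h0 : I.lastCut p j w = 0
      · omega
      obtain ⟨j', hj1, hj2, hc⟩ := I.isCut_of_lastCut_ne_zero h0
      exact I.le_lastCut_of_isCut hj1
        (by have := hlow w hw j' _ hj1 (hj2.trans hjL) hq₀p hc; omega) hq₀p hc
    omega
  -- all vertices of the segment before the cut have the same start and the same path level
  have hkey : ∀ u, I.rep j u = I.rep j w → q₀ ≤ I.pos u → I.pos u ≤ p →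
      I.start u = q₀ ∧ I.pathLevel u = i₀ := by
    intro u hu h1 h2
    have hul : I.rep l u = I.rep l v₀ := (I.rep_eq_of_le hlj hu).trans hw
    have hj' : I.lastCut (I.pos u) j u = q₀ := by
      rw [I.lastCut_congr hu]
      exact I.lastCut_eq_of_between h1 h2
    have hs : I.start u = q₀ := by
      refine le_antisymm ?_ (hj' ▸ I.lastCut_mono_level _ _ hjL)
      by_cases h0 : I.lastCut (I.pos u) I.L u = 0
      · exact (show I.start u = 0 from h0) ▸ Nat.zero_le _
      obtain ⟨j', hj1, hj2, hc⟩ := I.isCut_of_lastCut_ne_zero h0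
      have hle : I.lastCut (I.pos u) I.L u ≤ I.pos u := I.lastCut_le _ _ _
      have := hlow u hul j' _ hj1 hj2 (hle.trans h2) hc
      rw [← hj']
      exact I.le_lastCut_of_isCut hj1 (by omega) hle hc
    refine ⟨hs, I.pathLevel_eq_of_forall (P := fun i => I.lastCut p i w = q₀) hi1 hi2 hi3 ?_⟩
    intro i hi _
    have hij : i ≤ j := by omega
    rw [hs, I.lastCut_congr (I.rep_eq_of_le hij hu)]
    have hmono := I.lastCut_mono i w h2
    have hle : I.lastCut p i w ≤ q₀ := I.lastCut_mono_level p w hij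
    simp only at hmono
    constructor
    · intro h; omega
    · intro h
      rw [← h]
      exact I.lastCut_eq_of_between (h.le.trans h1) h2
  -- the segment holds at least `L * k + 1` vertices, the last of which is the cut itself
  set M := Finset.univ.filter fun u => I.rep j u = I.rep j w ∧ q₀ ≤ I.pos u ∧ I.pos u ≤ p + 1
  set M' := Finset.univ.filter fun u => I.rep j u = I.rep j w ∧ q₀ ≤ I.pos u ∧ I.pos u ≤ p
  have hMM : M.card ≤ M'.card + 1 := by
    have : M ⊆ M' ∪ Finset.univ.filter fun u => I.pos u = p + 1 := by
      intro u hu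
      simp only [M, M', Finset.mem_union, Finset.mem_filter, Finset.mem_univ, true_and] at hu ⊢
      by_cases h : I.pos u = p + 1
      · exact Or.inr h
      · exact Or.inl ⟨hu.1, hu.2.1, by omega⟩
    refine (Finset.card_le_card this).trans ((Finset.card_union_le _ _).trans ?_)
    refine Nat.add_le_add_left (Finset.card_le_one.2 fun a ha b hb => ?_) _
    simp only [Finset.mem_filter, Finset.mem_univ, true_and] at ha hb
    exact I.pos_inj (ha.trans hb.symm)
  have hthr : I.threshold ≤ M.card * M.card - M.card := by
    refine le_trans hcut ?_
    rw [← Finset.offDiag_card]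
    refine Finset.card_le_card fun x hx => ?_
    simp only [inversions, Finset.mem_filter, Finset.mem_univ, true_and] at hx
    obtain ⟨hinv, h1, h2, _, h3, h4⟩ := hx
    have := hinv.1
    simp only [M, Finset.mem_offDiag, Finset.mem_filter, Finset.mem_univ, true_and]
    exact ⟨⟨h1, by omega, by omega⟩, ⟨h2, by omega, by omega⟩, fun h => hinv.2.2.ne' h⟩
  have hM' : I.L * I.k ≤ M'.card := by
    by_contra hc
    have h1 : M.card ≤ I.L * I.k := by omega
    have h2 : M.card * M.card ≤ (I.L * I.k) * (I.L * I.k) := Nat.mul_le_mul h1 h1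
    have h3 : I.threshold = (I.L * I.k) * (I.L * I.k) := by unfold threshold; ring
    have h4 : 0 < I.threshold := by
      unfold threshold
      exact Nat.mul_pos (pow_pos I.L_pos 2) (pow_pos I.k_pos 2)
    have h5 : 0 < M.card := by
      rcases Nat.eq_zero_or_pos M.card with h | h
      · rw [h] at hthr; omega
      · exact h
    omega
  have hLpos := I.L_pos
  obtain ⟨b, hb, hbk⟩ := Finset.exists_le_card_fiber_of_mul_le_card_of_maps_to
    (s := M') (t := Finset.Icc 1 I.L) (f := I.classLevel) (n := I.k)
    (fun u _ => Finset.mem_Icc.2 ⟨I.one_le_classLevel u, I.classLevel_le u⟩)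
    ⟨1, Finset.mem_Icc.2 ⟨le_rfl, hLpos⟩⟩ (by simpa using hM')
  have hne : (M'.filter fun u => I.classLevel u = b).Nonempty :=
    Finset.card_pos.1 (I.k_pos.trans hbk)
  obtain ⟨x, hx⟩ := hne
  simp only [M', Finset.mem_filter, Finset.mem_univ, true_and] at hx
  obtain ⟨⟨hx1, hx2, hx3⟩, hxb⟩ := hx
  obtain ⟨hxs, hxl⟩ := hkey x hx1 hx2 hx3
  refine ⟨x, hxl ▸ hi₀l, hbk.trans (Finset.card_le_card fun u hu => ?_)⟩
  simp only [M', Finset.mem_filter, Finset.mem_univ, true_and] at hu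
  obtain ⟨⟨hu1, hu2, hu3⟩, hub⟩ := hu
  obtain ⟨hus, hul⟩ := hkey u hu1 hu2 hu3
  refine Finset.mem_filter.2 ⟨Finset.mem_filter.2 ⟨Finset.mem_univ _, ?_⟩,
    (I.rep_eq_of_le hlj hu1).trans hw⟩
  simp only [key, hus, hul, hxs, hxl, hub, hxb]
  rw [I.rep_eq_of_le (show i₀ ≤ j by omega) (hu1.trans hx1.symm)]

/-- The covering condition of a block of level `l`: if a vertex of the block lies on a path of level
at least `l`, then that path begins at a cut inside the block. -/
theorem covered_or_exists_long_path {l : ℕ} (hl : 2 ≤ l) (v₀ : V) :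
    (∀ v, I.rep l v = I.rep l v₀ → I.pathLevel v < l) ∨
    ∃ x, I.pathLevel x < l ∧
      I.k ≤ ((I.pathSet x).filter fun u => I.rep l u = I.rep l v₀).card := by
  classical
  by_cases hall : ∀ v, I.rep l v = I.rep l v₀ → I.pathLevel v < l
  · exact Or.inl hall
  refine Or.inr ?_
  push Not at hall
  obtain ⟨v, hv, hlv⟩ := hall
  have hs : I.start v ≠ 0 := fun h => by have := I.pathLevel_eq_one h; omega
  have hex : ∃ q, ∃ j w, l ≤ j ∧ j ≤ I.L ∧ I.rep l w = I.rep l v₀ ∧ I.IsCut j w q :=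
    ⟨_, _, v, hlv, I.pathLevel_le v, hv, I.isCut_start hs⟩
  obtain ⟨j, w, h1, h2, h3, h4⟩ := Nat.find_spec hex
  exact I.exists_long_path_of_isCut hl h1 h2 h3 h4 fun q' hq' j' u h1 h2 h3 h4 =>
    Nat.find_min hex hq' ⟨j', u, h1, h2, h3, h4⟩

/-! ### The number of paths -/

/-- Between consecutive cuts of a block lie `threshold` of its inversions, and these sets are
disjoint. -/
theorem threshold_mul_card_isCut_le {j : ℕ} (hj : 1 ≤ j) (r : V) (p : ℕ) :
    I.threshold * ((Finset.range (p + 1)).filter (I.IsCut j r)).card ≤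
      (I.inversions j r 0 (I.lastCut p j r)).card := by
  have hmono : ∀ a b b', b ≤ b' → I.inversions j r a b ⊆ I.inversions j r a b' := by
    intro a b b' h x hx
    simp only [inversions, Finset.mem_filter, Finset.mem_univ, true_and] at hx ⊢
    exact ⟨hx.1, hx.2.1, hx.2.2.1, hx.2.2.2.1, hx.2.2.2.2.1, hx.2.2.2.2.2.trans h⟩
  induction p with
  | zero =>
    have : (Finset.range (0 + 1)).filter (I.IsCut j r) = ∅ := by
      refine Finset.filter_eq_empty_iff.2 fun x hx => ?_
      obtain rfl : x = 0 := by simpa using hx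
      exact fun h => h.elim
    rw [this]
    simp
  | succ p ih =>
    rw [Finset.range_add_one, Finset.filter_insert]
    split_ifs with hc
    · rw [Finset.card_insert_of_notMem (by simp), I.lastCut_of_isCut hj le_rfl hc, mul_add, mul_one]
      refine (Nat.add_le_add ih hc).trans ?_
      rw [← Finset.card_union_of_disjoint]
      · refine Finset.card_le_card (Finset.union_subset (hmono _ _ _ ?_) ?_)
        · exact (I.lastCut_le _ _ _).trans (Nat.le_succ p)
        · intro x hx
          simp only [inversions, Finset.mem_filter, Finset.mem_univ, true_and] at hx ⊢
          exact ⟨hx.1, hx.2.1, hx.2.2.1, hx.2.2.2.1, Nat.zero_le _, hx.2.2.2.2.2⟩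
      · refine Finset.disjoint_left.2 fun x hx hx' => ?_
        simp only [inversions, Finset.mem_filter, Finset.mem_univ, true_and] at hx hx'
        have := hx.1.1
        omega
    · exact ih.trans (Finset.card_le_card (hmono _ _ _ (I.lastCut_mono j r (Nat.le_succ p))))

/-- The total cost of the inverted pairs. -/
noncomputable def inversionCost : ℝ :=
  ∑ p ∈ Finset.univ.filter (fun p : V × V => I.Inverted p.1 p.2), I.c p.1 p.2

/-- The `k`-hop cost of the enumeration by time, cut open at its end. -/
noncomputable def tourCost : ℝ := setHopCost I.c I.k I.pos Finset.univ

/-- The cuts of all blocks, each block being represented by its least vertex. -/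
def cuts : Finset (ℕ × V × ℕ) :=
  (Finset.Icc 1 I.L ×ˢ (Finset.univ ×ˢ Finset.range (Fintype.card V))).filter fun t =>
    I.rep t.1 t.2.1 = t.2.1 ∧ I.IsCut t.1 t.2.1 t.2.2

/-- An inverted pair is counted at a single level and in a single block, and costs at least the
bound of that level. -/
theorem threshold_mul_sum_cuts_le :
    (I.threshold : ℝ) * ∑ t ∈ I.cuts, I.D t.1 ≤ I.inversionCost := by
  classical
  set n := Fintype.card V with hn
  set J := (Finset.Icc 1 I.L ×ˢ (Finset.univ : Finset V)).filter fun t => I.rep t.1 t.2 = t.2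
    with hJ
  have h1 : ∑ t ∈ I.cuts, I.D t.1 =
      ∑ t ∈ J, ∑ q ∈ (Finset.range n).filter (I.IsCut t.1 t.2), I.D t.1 := by
    rw [Finset.sum_sigma']
    refine Finset.sum_nbij' (fun t => ⟨(t.1, t.2.1), t.2.2⟩) (fun t => (t.1.1, t.1.2, t.2))
      ?_ ?_ ?_ ?_ ?_
    · intro t ht
      simp only [cuts, hJ, Finset.mem_filter, Finset.mem_product, Finset.mem_sigma,
        Finset.mem_univ, true_and, and_true] at ht ⊢
      tauto
    · intro t ht
      simp only [cuts, hJ, Finset.mem_filter, Finset.mem_product, Finset.mem_sigma,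
        Finset.mem_univ, true_and, and_true] at ht ⊢
      tauto
    · intros; rfl
    · intros; rfl
    · intros; rfl
  have h2 : ∀ t ∈ J, (I.threshold : ℝ) *
      ∑ q ∈ (Finset.range n).filter (I.IsCut t.1 t.2), I.D t.1 ≤
      ∑ p ∈ I.inversions t.1 t.2 0 n, I.c p.1 p.2 := by
    intro t ht
    simp only [hJ, Finset.mem_filter, Finset.mem_product, Finset.mem_Icc] at ht
    have h3 : I.threshold * ((Finset.range n).filter (I.IsCut t.1 t.2)).card ≤
        (I.inversions t.1 t.2 0 n).card := by
      refine le_trans ?_ ((I.threshold_mul_card_isCut_le ht.1.1.1 t.2 n).trans ?_)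
      · exact Nat.mul_le_mul_left _ (Finset.card_le_card
          (Finset.filter_subset_filter _ (Finset.range_subset_range.2 (Nat.le_succ n))))
      · refine Finset.card_le_card fun x hx => ?_
        have := I.lastCut_le n t.1 t.2
        simp only [inversions, Finset.mem_filter, Finset.mem_univ, true_and] at hx ⊢
        exact ⟨hx.1, hx.2.1, hx.2.2.1, hx.2.2.2.1, hx.2.2.2.2.1, by omega⟩
    have h4 : ((I.inversions t.1 t.2 0 n).card : ℝ) * I.D t.1 ≤
        ∑ p ∈ I.inversions t.1 t.2 0 n, I.c p.1 p.2 := by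
      rw [← nsmul_eq_mul]
      refine Finset.card_nsmul_le_sum _ _ _ fun p hp => ?_
      simp only [inversions, Finset.mem_filter, Finset.mem_univ, true_and] at hp
      exact I.le_c _ _ _ hp.1.2.2 hp.2.2.2.1
    refine le_trans ?_ h4
    rw [Finset.sum_const, nsmul_eq_mul, ← mul_assoc]
    refine mul_le_mul_of_nonneg_right ?_ (I.D_nonneg _)
    exact_mod_cast h3
  rw [h1, Finset.mul_sum]
  refine (Finset.sum_le_sum h2).trans ?_
  rw [← Finset.sum_biUnion, inversionCost]
  · refine Finset.sum_le_sum_of_subset_of_nonneg ?_ fun _ _ _ => I.c_nonneg _ _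
    intro p hp
    obtain ⟨t, _, hp⟩ := Finset.mem_biUnion.1 hp
    simp only [inversions, Finset.mem_filter, Finset.mem_univ, true_and] at hp ⊢
    exact hp.1
  · intro t ht t' ht' hne
    refine Finset.disjoint_left.2 fun p hp hp' => hne ?_
    simp only [hJ, Finset.coe_filter, Finset.mem_product, Set.mem_ofPred_eq] at ht ht'
    simp only [inversions, Finset.mem_filter, Finset.mem_univ, true_and] at hp hp'
    obtain ⟨_, a1, a2, a3, _⟩ := hp
    obtain ⟨_, b1, b2, b3, _⟩ := hp'
    have e : t.1 = t'.1 := by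
      rcases lt_trichotomy t.1 t'.1 with h | h | h
      · exact absurd (I.rep_eq_of_le h (b1.trans b2.symm)) a3
      · exact h
      · exact absurd (I.rep_eq_of_le h (a1.trans a2.symm)) b3
    refine Prod.ext e ?_
    rw [← ht.2, ← ht'.2, ← a1, ← b1, e]

/-- There are at most `L` paths for each cut, and `L` more that start with the tour. -/
theorem sum_keys_le : (I.k : ℝ) ^ 2 * ∑ κ ∈ Finset.univ.image I.key, I.D κ.1 ≤
    I.L * ((I.k : ℝ) ^ 2 * I.D 1) + I.inversionCost := by
  classical
  set K := Finset.univ.image I.key with hK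
  have h0 : ∑ κ ∈ K.filter (fun κ => κ.2.2.2 = 0), I.D κ.1 ≤ I.L * I.D 1 := by
    have hc : (K.filter fun κ => κ.2.2.2 = 0).card ≤ I.L := by
      rw [show I.L = (Finset.Icc 1 I.L).card by simp]
      refine Finset.card_le_card_of_injOn (fun κ => κ.2.1) ?_ ?_
      · intro κ hκ
        simp only [hK, Finset.coe_filter, Finset.mem_image, Set.mem_ofPred_eq, Finset.mem_univ,
          true_and] at hκ
        obtain ⟨⟨v, rfl⟩, _⟩ := hκ
        exact Finset.mem_coe.2 (Finset.mem_Icc.2 ⟨I.one_le_classLevel v, I.classLevel_le v⟩)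
      · intro κ hκ κ' hκ' h
        simp only [hK, Finset.coe_filter, Finset.mem_image, Set.mem_ofPred_eq, Finset.mem_univ,
          true_and] at hκ hκ'
        obtain ⟨⟨v, rfl⟩, hv⟩ := hκ
        obtain ⟨⟨v', rfl⟩, hv'⟩ := hκ'
        simp only [key] at hv hv' h ⊢
        rw [I.pathLevel_eq_one hv, I.pathLevel_eq_one hv', hv, hv', h, I.rep_one v v']
    refine (Finset.sum_le_card_nsmul _ _ (I.D 1) fun κ hκ => ?_).trans ?_
    · simp only [hK, Finset.mem_filter, Finset.mem_image, Finset.mem_univ, true_and] at hκ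
      obtain ⟨⟨v, rfl⟩, _⟩ := hκ
      exact I.D_anti (I.one_le_pathLevel v)
    · rw [nsmul_eq_mul]
      exact mul_le_mul_of_nonneg_right (by exact_mod_cast hc) (I.D_nonneg 1)
  have h1 : ∑ κ ∈ K.filter (fun κ => ¬ κ.2.2.2 = 0), I.D κ.1 ≤ I.L * ∑ t ∈ I.cuts, I.D t.1 := by
    have e : (I.L : ℝ) * ∑ t ∈ I.cuts, I.D t.1 =
        ∑ x ∈ Finset.Icc 1 I.L ×ˢ I.cuts, I.D x.2.1 := by
      rw [Finset.sum_product]; simp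
    rw [e, ← Finset.sum_image (s := Finset.Icc 1 I.L ×ˢ I.cuts)
      (g := fun x => ((x.2.1, x.1, x.2.2.1, x.2.2.2) : ℕ × ℕ × V × ℕ)) (f := fun κ => I.D κ.1)]
    · refine Finset.sum_le_sum_of_subset_of_nonneg ?_ fun _ _ _ => I.D_nonneg _
      intro κ hκ
      simp only [hK, Finset.mem_filter, Finset.mem_image, Finset.mem_univ, true_and] at hκ
      obtain ⟨⟨v, rfl⟩, hv⟩ := hκ
      refine Finset.mem_image.2 ⟨(I.classLevel v, I.pathLevel v, I.rep (I.pathLevel v) v,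
        I.start v), ?_, rfl⟩
      have hlt : I.start v < Fintype.card V := (I.lastCut_le _ _ _).trans_lt (I.pos_lt v)
      simp only [cuts, Finset.mem_product, Finset.mem_filter, Finset.mem_Icc, Finset.mem_univ,
        Finset.mem_range, true_and]
      exact ⟨⟨I.one_le_classLevel v, I.classLevel_le v⟩, ⟨⟨I.one_le_pathLevel v, I.pathLevel_le v⟩,
        hlt⟩, I.rep_rep _ _, (I.isCut_congr (I.rep_rep _ v) _).2 (I.isCut_start hv)⟩
    · rintro ⟨a, b, c, d⟩ _ ⟨a', b', c', d'⟩ _ h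
      simp only [Prod.mk.injEq] at h ⊢
      tauto
  rw [← Finset.sum_filter_add_sum_filter_not K (fun κ => κ.2.2.2 = 0)]
  have hS : 0 ≤ ∑ t ∈ I.cuts, I.D t.1 := Finset.sum_nonneg fun _ _ => I.D_nonneg _
  have h2 := I.threshold_mul_sum_cuts_le
  have hL : (1 : ℝ) ≤ I.L := by exact_mod_cast I.L_pos
  have h3 : (I.k : ℝ) ^ 2 * (I.L * ∑ t ∈ I.cuts, I.D t.1) ≤
      (I.threshold : ℝ) * ∑ t ∈ I.cuts, I.D t.1 := by
    rw [← mul_assoc]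
    refine mul_le_mul_of_nonneg_right ?_ hS
    unfold threshold
    push_cast
    nlinarith [mul_nonneg (sq_nonneg (I.k : ℝ))
      (mul_nonneg (sub_nonneg.2 hL) (zero_le_one.trans hL))]
  have h4 := mul_le_mul_of_nonneg_left h0 (sq_nonneg (I.k : ℝ))
  have h5 := mul_le_mul_of_nonneg_left h1 (sq_nonneg (I.k : ℝ))
  linarith

/-! ### The cost of the paths -/

theorem inversionCost_eq_sum :
    I.inversionCost = ∑ x, ∑ y, if I.Inverted x y then I.c x y else 0 := by
  rw [inversionCost, Finset.sum_filter, Fintype.sum_prod_type]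

theorem tourCost_nonneg : 0 ≤ I.tourCost :=
  Finset.sum_nonneg fun _ _ => Finset.sum_nonneg fun _ _ => by
    split_ifs
    · exact I.c_nonneg _ _
    · exact le_rfl

/-- Inverted pairs have distance at most `4 * scale * k` in the tour, and `scale ^ 2` is of order
`L ^ 3`. -/
theorem inversionCost_le : I.inversionCost ≤ 64 * (I.L : ℝ) ^ 3 * I.tourCost := by
  have h1 : I.inversionCost ≤ setHopCost I.c (4 * I.scale * I.k) I.pos Finset.univ := by
    rw [inversionCost_eq_sum, setHopCost]
    refine Finset.sum_le_sum fun x _ => Finset.sum_le_sum fun y _ => ?_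
    by_cases h : I.Inverted x y
    · have hd : keyDist I.pos Finset.univ x y ≤ 4 * I.scale * I.k := by
        have h2 : keyDist I.pos Finset.univ x y ≤ I.pos y - I.pos x := by
          rw [keyDist, ← Nat.card_Ioc, ← Finset.card_image_of_injective _ I.pos_inj]
          refine Finset.card_le_card fun t ht => ?_
          simp only [Finset.mem_image, Finset.mem_filter, Finset.mem_univ, true_and] at ht
          obtain ⟨z, hz, rfl⟩ := ht
          exact Finset.mem_Ioc.2 hz
        have h3 := h.2.1
        rw [window, ← mul_assoc] at h3
        omega
      rw [if_pos h, if_pos ⟨h.1, hd⟩]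
    · rw [if_neg h]
      split_ifs
      · exact I.c_nonneg _ _
      · exact le_rfl
  have h2 := setHopCost_mul_le I.tri I.c_nonneg I.pos_inj I.k (4 * I.scale) Finset.univ
  have h3 : I.scale * I.scale ≤ 4 * I.L ^ 3 := by
    have h4 := Nat.sqrt_le (I.L ^ 3)
    have h5 : 1 ≤ Nat.sqrt (I.L ^ 3) := Nat.sqrt_pos.2 (pow_pos I.L_pos 3)
    unfold scale
    nlinarith
  have h4 : ((4 * I.scale : ℕ) : ℝ) ^ 2 ≤ 64 * (I.L : ℝ) ^ 3 := by
    have : (4 * I.scale) ^ 2 ≤ 64 * I.L ^ 3 := by nlinarith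
    exact_mod_cast this
  exact h1.trans (h2.trans (mul_le_mul_of_nonneg_right h4 I.tourCost_nonneg))

/-- Bound for the distance of two vertices in a common block of level `b`. Blocks of level `L` are
singletons and get `0`, whatever `D L` is. -/
noncomputable def blockDiam (b : ℕ) : ℝ := if b < I.L then I.D b else 0

theorem blockDiam_nonneg (b : ℕ) : 0 ≤ I.blockDiam b := by
  unfold blockDiam
  split_ifs
  · exact I.D_nonneg b
  · exact le_rfl

theorem c_le_blockDiam {b : ℕ} {x y : V} (h : I.rep b x = I.rep b y) :
    I.c x y ≤ I.blockDiam b := by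
  unfold blockDiam
  split_ifs with hb
  · exact I.c_le b x y h
  · rw [I.rep_L x y (I.rep_eq_of_le (not_lt.1 hb) h), I.c_self]

/-- A vertex of class level `b < L` has `k` conflicts, each of cost at least `D b`. -/
theorem sum_blockDiam_le : ∑ v, (I.k : ℝ) * I.blockDiam (I.classLevel v) ≤ 2 * I.inversionCost := by
  have h1 : ∀ v, (I.k : ℝ) * I.blockDiam (I.classLevel v) ≤
      (∑ w, if I.Inverted v w then I.c v w else 0) +
      ∑ w, if I.Inverted w v then I.c w v else 0 := by
    intro v
    rw [← Finset.sum_add_distrib]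
    have hnn : ∀ w, 0 ≤ (if I.Inverted v w then I.c v w else 0) +
        (if I.Inverted w v then I.c w v else 0) := by
      intro w
      have := I.c_nonneg v w
      have := I.c_nonneg w v
      split_ifs <;> linarith
    by_cases hL : I.classLevel v < I.L
    · have h2 := I.le_card_conflicts hL
      rw [blockDiam, if_pos hL]
      calc (I.k : ℝ) * I.D (I.classLevel v)
          ≤ (I.conflicts (I.classLevel v + 1) v).card * I.D (I.classLevel v) :=
            mul_le_mul_of_nonneg_right (by exact_mod_cast h2) (I.D_nonneg _)
        _ ≤ ∑ w ∈ I.conflicts (I.classLevel v + 1) v, ((if I.Inverted v w then I.c v w else 0) +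
              (if I.Inverted w v then I.c w v else 0)) := by
            rw [← nsmul_eq_mul]
            refine Finset.card_nsmul_le_sum _ _ _ fun w hw => ?_
            simp only [conflicts, Finset.mem_filter, Finset.mem_univ, true_and] at hw
            obtain ⟨h | h, hne⟩ := hw
            · have := I.le_c _ _ _ h.2.2 hne
              have := I.c_nonneg w v
              rw [if_pos h]
              split_ifs <;> linarith
            · have := I.le_c _ _ _ h.2.2 hne.symm
              have := I.c_nonneg v w
              rw [if_pos h]
              split_ifs <;> linarith
        _ ≤ _ := Finset.sum_le_sum_of_subset_of_nonneg (Finset.subset_univ _) fun w _ _ => hnn w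
    · rw [blockDiam, if_neg hL, mul_zero]
      exact Finset.sum_nonneg fun w _ => hnn w
  refine (Finset.sum_le_sum fun v _ => h1 v).trans ?_
  rw [Finset.sum_add_distrib]
  nth_rw 2 [Finset.sum_comm]
  rw [← inversionCost_eq_sum]
  linarith

/-- The path with a given key: its vertices in increasing order. -/
def pathList (κ : ℕ × ℕ × V × ℕ) : List V :=
  (Finset.univ.filter fun v => I.key v = κ).sort (· ≤ ·)

/-- The charge of a pair `(x, y)` of vertices of one path. If `x` comes first in time, the pair is
charged its cost once it is within `3 * k` steps among the vertices of the same path level and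
class. If `y, x` is inverted, it is charged the cost of that inversion, which is at least `c x y`.
-/
noncomputable def pairCharge (x y : V) : ℝ :=
  (if I.pos x < I.pos y ∧ keyDist I.pos (I.levelClass (I.pathLevel x) (I.classLevel x)) x y ≤
    3 * I.k then I.c x y else 0) + if I.Inverted y x then I.c y x else 0

theorem pairCharge_nonneg (x y : V) : 0 ≤ I.pairCharge x y := by
  unfold pairCharge
  have := I.c_nonneg x y
  have := I.c_nonneg y x
  split_ifs <;> linarith

theorem c_le_c_swap {x y : V} (h : x < y) : I.c x y ≤ I.c y x := by
  have hne : I.rep I.L x ≠ I.rep I.L y := fun h' => h.ne (I.rep_L _ _ h')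
  obtain ⟨i, _, _, h1, h2⟩ := I.exists_level hne
  exact (I.c_le i x y h1).trans (I.le_c i y x h h2.symm)

/-- Ordered by blocks of its class level and by time within the blocks, a path costs no more than
what its pairs of vertices are charged. -/
theorem setHopCost_pathSet_le (v : V) (hv : I.pathLevel v < I.classLevel v) :
    setHopCost I.c I.k (I.blockKey (I.classLevel v)) (I.pathSet v) ≤
      ∑ x ∈ I.pathSet v, ∑ y ∈ I.pathSet v, I.pairCharge x y := by
  refine Finset.sum_le_sum fun x hx => Finset.sum_le_sum fun y hy => ?_
  split_ifs with h
  · obtain ⟨hlt, hd⟩ := h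
    have hx : I.key x = I.key v := (Finset.mem_filter.1 hx).2
    have hy : I.key y = I.key v := (Finset.mem_filter.1 hy).2
    have e1 : I.pathLevel x = I.pathLevel v := congrArg (·.1) hx
    have e2 : I.classLevel x = I.classLevel v := congrArg (·.2.1) hx
    have e2y : I.classLevel y = I.classLevel v := congrArg (·.2.1) hy
    have e3 : I.pathSet x = I.pathSet v := by unfold pathSet; rw [hx]
    have hxy := hx.trans hy.symm
    unfold pairCharge
    have hne : x ≠ y := fun h => by rw [h] at hlt; exact lt_irrefl _ hlt
    rcases lt_or_gt_of_ne (fun h => hne (I.pos_inj h)) with hp | hp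
    · rw [← e1, ← e2] at hv
      rw [← e2, ← e3] at hd
      rw [if_pos ⟨hp, I.keyDist_pos_le hxy hv hp hd⟩]
      have := I.c_nonneg y x
      split_ifs <;> linarith
    · have hr : I.rep (I.classLevel y) x < I.rep (I.classLevel y) y := by
        rw [e2y]
        exact (I.blockKey_lt.1 hlt).resolve_right fun h => lt_asymm h.2 hp
      have hinv := I.inverted_of_key_eq hxy.symm hp hr
      rw [if_pos hinv]
      have := I.c_le_c_swap hinv.2.2
      have := I.c_nonneg x y
      split_ifs <;> linarith
  · exact I.pairCharge_nonneg x y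

/-- A path in increasing order, compared with the same path in its block order: position by position
the two agree up to the diameter of a block of the class level. If the path level is at least the
class level, the whole path lies in one such block. -/
theorem pathHopCost_pathList_le (v : V) :
    pathHopCost I.c I.k (I.pathList (I.key v)) ≤
      2 * (I.k * (I.pathSet v).card * I.blockDiam (I.classLevel v)) +
      ∑ x ∈ I.pathSet v, ∑ y ∈ I.pathSet v, I.pairCharge x y := by
  have hlen : (I.pathList (I.key v)).length = (I.pathSet v).card := Finset.length_sort _
  have hδ := I.blockDiam_nonneg (I.classLevel v)
  have hsum : 0 ≤ ∑ x ∈ I.pathSet v, ∑ y ∈ I.pathSet v, I.pairCharge x y :=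
    Finset.sum_nonneg fun _ _ => Finset.sum_nonneg fun _ _ => I.pairCharge_nonneg _ _
  have hpos : 0 ≤ (I.k * (I.pathSet v).card * I.blockDiam (I.classLevel v)) := by positivity
  rcases lt_or_ge (I.pathLevel v) (I.classLevel v) with hv | hv
  · obtain ⟨w, hw, hsorted⟩ := exists_list_pairwise_key_lt
      (I.blockKey_injective (I.classLevel v)) (I.pathSet v)
    have hnd : w.Nodup := hsorted.imp fun h h' => by rw [h'] at h; exact lt_irrefl _ h
    -- both orders list the blocks of the class level in increasing order
    have hmap : (I.pathList (I.key v)).map (I.rep (I.classLevel v)) =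
        w.map (I.rep (I.classLevel v)) := by
      have hperm : (I.pathList (I.key v)).Perm w := by
        refine (List.perm_ext_iff_of_nodup (Finset.sort_nodup _ _) hnd).2 fun a => ?_
        have h1 : a ∈ I.pathList (I.key v) ↔ a ∈ I.pathSet v := Finset.mem_sort _
        exact h1.trans (by rw [← hw, List.mem_toFinset])
      refine List.Perm.eq_of_pairwise' (r := (· ≤ ·)) ?_ ?_ (hperm.map _)
      · refine List.Pairwise.map _ (fun a b h => I.rep_mono _ h) (Finset.pairwise_sort _ _)
      · refine List.Pairwise.map _ (fun a b h => ?_) hsorted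
        rcases I.blockKey_lt.1 h with h | h
        · exact h.le
        · exact h.1.le
    have h1 := pathHopCost_le_of_forall₂ I.tri hδ I.k (List.forall₂_of_map_eq hmap
      fun x y h => ⟨I.c_le_blockDiam h, I.c_le_blockDiam h.symm⟩)
    have h2 := I.setHopCost_pathSet_le v hv
    rw [pathHopCost_eq_setHopCost I.c I.k _ hsorted, hw, hlen] at h1
    linarith
  · have h1 := pathHopCost_le_mul_length (c := I.c) hδ I.k (u := I.pathList (I.key v)) (by
      intro x hx y hy
      rw [pathList, Finset.mem_sort, Finset.mem_filter] at hx hy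
      have hxy := hx.2.trans hy.2.symm
      have e1 : I.pathLevel x = I.pathLevel v := congrArg (·.1) hx.2
      have e2 : I.pathLevel y = I.pathLevel v := congrArg (·.1) hy.2
      have e3 : I.rep (I.pathLevel x) x = I.rep (I.pathLevel y) y := congrArg (·.2.2.1) hxy
      rw [e1, e2] at e3
      exact I.c_le_blockDiam (I.rep_eq_of_le hv e3))
    rw [hlen] at h1
    linarith

/-- The vertices of each path level and class form a subset of the tour, so their `3 * k`-hop cost
is at most nine times that of the tour; there are `L ^ 2` such subsets. Inverted pairs are charged
once. -/
theorem sum_pairCharge_le :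
    ∑ x, ∑ y ∈ Finset.univ.filter (fun y => I.key y = I.key x), I.pairCharge x y ≤
      9 * (I.L : ℝ) ^ 2 * I.tourCost + I.inversionCost := by
  simp only [pairCharge, Finset.sum_add_distrib]
  refine add_le_add ?_ ?_
  · set F : V → V → ℝ := fun x y => if I.pos x < I.pos y ∧
      keyDist I.pos (I.levelClass (I.pathLevel x) (I.classLevel x)) x y ≤ 3 * I.k
      then I.c x y else 0 with hF
    have hFnn : ∀ x y, 0 ≤ F x y := fun x y => by
      have := I.c_nonneg x y
      simp only [hF]
      split_ifs <;> linarith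
    calc ∑ x, ∑ y ∈ Finset.univ.filter (fun y => I.key y = I.key x), F x y
        ≤ ∑ x, ∑ y ∈ I.levelClass (I.pathLevel x) (I.classLevel x), F x y := by
          refine Finset.sum_le_sum fun x _ =>
            Finset.sum_le_sum_of_subset_of_nonneg ?_ fun _ _ _ => hFnn _ _
          intro y hy
          simp only [levelClass, Finset.mem_filter, Finset.mem_univ, true_and] at hy ⊢
          exact ⟨congrArg (·.1) hy, congrArg (·.2.1) hy⟩
      _ = ∑ t ∈ Finset.Icc 1 I.L ×ˢ Finset.Icc 1 I.L,
            setHopCost I.c (3 * I.k) I.pos (I.levelClass t.1 t.2) := by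
          rw [← Finset.sum_fiberwise_of_maps_to (t := Finset.Icc 1 I.L ×ˢ Finset.Icc 1 I.L)
            (g := fun x => (I.pathLevel x, I.classLevel x)) (fun x _ => by
              simp [I.one_le_pathLevel, I.pathLevel_le, I.one_le_classLevel, I.classLevel_le])]
          refine Finset.sum_congr rfl fun t _ => ?_
          have e : (Finset.univ.filter fun x => (I.pathLevel x, I.classLevel x) = t) =
              I.levelClass t.1 t.2 := by
            ext x
            simp [levelClass, Prod.ext_iff]
          rw [e, setHopCost]
          refine Finset.sum_congr rfl fun x hx => ?_
          simp only [levelClass, Finset.mem_filter, Finset.mem_univ, true_and] at hx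
          simp only [hF, hx.1, hx.2]
      _ ≤ ∑ t ∈ Finset.Icc 1 I.L ×ˢ Finset.Icc 1 I.L, 9 * I.tourCost := by
          refine Finset.sum_le_sum fun t _ => ?_
          have h1 := setHopCost_mul_le I.tri I.c_nonneg I.pos_inj I.k 3 (I.levelClass t.1 t.2)
          have h2 := setHopCost_mono I.tri I.c_nonneg I.pos_inj I.k
            (Finset.subset_univ (I.levelClass t.1 t.2))
          push_cast at h1
          unfold tourCost
          linarith
      _ = 9 * (I.L : ℝ) ^ 2 * I.tourCost := by
          rw [Finset.sum_const, Finset.card_product, Nat.card_Icc, nsmul_eq_mul]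
          push_cast [Nat.add_sub_cancel]
          ring
  · rw [inversionCost_eq_sum, Finset.sum_comm (s := Finset.univ) (t := Finset.univ)]
    refine Finset.sum_le_sum fun x _ =>
      Finset.sum_le_sum_of_subset_of_nonneg (Finset.subset_univ _) fun y _ _ => ?_
    split_ifs
    · exact I.c_nonneg _ _
    · exact le_rfl

theorem sum_pathHopCost_le :
    ∑ κ ∈ Finset.univ.image I.key, pathHopCost I.c I.k (I.pathList κ) ≤
      9 * (I.L : ℝ) ^ 2 * I.tourCost + 5 * I.inversionCost := by
  classical
  have h1 : ∀ κ ∈ Finset.univ.image I.key, pathHopCost I.c I.k (I.pathList κ) ≤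
      ∑ x ∈ Finset.univ.filter (fun x => I.key x = κ),
        (2 * (I.k * I.blockDiam (I.classLevel x)) +
          ∑ y ∈ Finset.univ.filter (fun y => I.key y = I.key x), I.pairCharge x y) := by
    intro κ hκ
    obtain ⟨v, _, rfl⟩ := Finset.mem_image.1 hκ
    refine (I.pathHopCost_pathList_le v).trans (le_of_eq ?_)
    rw [Finset.sum_add_distrib]
    congr 1
    · rw [Finset.sum_congr rfl (g := fun _ => 2 * (I.k * I.blockDiam (I.classLevel v)))]
      · rw [Finset.sum_const, nsmul_eq_mul, pathSet]
        ring
      · intro x hx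
        have : I.classLevel x = I.classLevel v := congrArg (·.2.1) (Finset.mem_filter.1 hx).2
        rw [this]
    · refine Finset.sum_congr rfl fun x hx => ?_
      rw [(Finset.mem_filter.1 hx).2]
      rfl
  refine (Finset.sum_le_sum h1).trans ?_
  rw [Finset.sum_fiberwise_of_maps_to (fun x _ => Finset.mem_image_of_mem _ (Finset.mem_univ x)),
    Finset.sum_add_distrib, ← Finset.mul_sum]
  have h2 := I.sum_blockDiam_le
  have h3 := I.sum_pairCharge_le
  linarith

/-- The total weight of the paths, in terms of the cost of the tour and of the root level. -/
theorem sum_weight_le :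
    ∑ κ ∈ Finset.univ.image I.key,
      (pathHopCost I.c I.k (I.pathList κ) + (I.k : ℝ) ^ 2 * I.D κ.1) ≤
      393 * (I.L : ℝ) ^ 3 * I.tourCost + I.L * ((I.k : ℝ) ^ 2 * I.D 1) := by
  rw [Finset.sum_add_distrib, ← Finset.mul_sum]
  have h1 := I.sum_pathHopCost_le
  have h2 := I.sum_keys_le
  have h3 := I.inversionCost_le
  have hL : (1 : ℝ) ≤ I.L := by exact_mod_cast I.L_pos
  have h4 : (I.L : ℝ) ^ 2 * I.tourCost ≤ (I.L : ℝ) ^ 3 * I.tourCost :=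
    mul_le_mul_of_nonneg_right (pow_le_pow_right₀ hL (by norm_num)) I.tourCost_nonneg
  linarith

end TimedHierarchy

/-! ### From instances to timed hierarchies -/

namespace HierOrderedInstance

variable {V : Type*} [Fintype V] [LinearOrder V] (I : HierOrderedInstance V)

/-- The level in `1, …, L` closest to `i`. Levels outside this range carry no information in an
instance. -/
def clamp (i : ℕ) : ℕ := max 1 (min i I.L)

theorem one_le_clamp (i : ℕ) : 1 ≤ I.clamp i := le_max_left _ _

theorem clamp_le (i : ℕ) : I.clamp i ≤ I.L := max_le I.one_le_L (min_le_right _ _)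

theorem clamp_eq {i : ℕ} (h1 : 1 ≤ i) (h2 : i ≤ I.L) : I.clamp i = i := by
  unfold clamp; omega

theorem clamp_succ (i : ℕ) : I.clamp (i + 1) = I.clamp i ∨
    I.clamp (i + 1) = I.clamp i + 1 ∧ I.clamp i < I.L := by
  have := I.one_le_L
  unfold clamp; omega

/-- The least vertex of the block of `v` at level `clamp i`. -/
def blockRep (i : ℕ) (v : V) : V :=
  ((I.H (I.clamp i)).part v).min' ⟨v, Finpartition.mem_part _ (Finset.mem_univ v)⟩

theorem part_mem_parts (i : ℕ) (v : V) : (I.H i).part v ∈ (I.H i).parts :=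
  (Finpartition.part_mem _).2 (Finset.mem_univ v)

theorem part_eq_iff_mem {i : ℕ} {x y : V} :
    (I.H i).part x = (I.H i).part y ↔ x ∈ (I.H i).part y :=
  (Finpartition.mem_part_iff_part_eq_part _ (Finset.mem_univ _) (Finset.mem_univ _)).symm

theorem part_blockRep (i : ℕ) (v : V) :
    (I.H (I.clamp i)).part (I.blockRep i v) = (I.H (I.clamp i)).part v :=
  I.part_eq_iff_mem.2 (Finset.min'_mem _ _)

theorem blockRep_eq_iff {i : ℕ} {x y : V} :
    I.blockRep i x = I.blockRep i y ↔ (I.H (I.clamp i)).part x = (I.H (I.clamp i)).part y := by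
  constructor
  · intro h
    rw [← I.part_blockRep, h, I.part_blockRep]
  · intro h
    simp only [blockRep, h]

theorem blockRep_mono (i : ℕ) : Monotone (I.blockRep i) := by
  intro x y hxy
  by_contra hc
  have hlt := not_le.1 hc
  have hy : I.blockRep i y ∈ (I.H (I.clamp i)).part y := Finset.min'_mem _ _
  have hx : I.blockRep i x ≤ x :=
    Finset.min'_le _ _ (Finpartition.mem_part _ (Finset.mem_univ x))
  have hconn := I.compatible (I.clamp i) (I.one_le_clamp i) (I.clamp_le i) _
    (I.part_mem_parts _ y)
  have hmem : x ∈ (I.H (I.clamp i)).part y := by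
    have := hconn.out (Finset.mem_coe.2 hy)
      (Finset.mem_coe.2 (Finpartition.mem_part (I.H (I.clamp i)) (Finset.mem_univ y)))
    exact Finset.mem_coe.1 (this ⟨(hlt.le.trans hx), hxy⟩)
  rw [I.blockRep_eq_iff.2 (I.part_eq_iff_mem.2 hmem)] at hlt
  exact lt_irrefl _ hlt

theorem blockRep_succ (i : ℕ) (x y : V) (h : I.blockRep (i + 1) x = I.blockRep (i + 1) y) :
    I.blockRep i x = I.blockRep i y := by
  rw [I.blockRep_eq_iff] at h ⊢
  rcases I.clamp_succ i with e | ⟨e, hL⟩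
  · rwa [e] at h
  · rw [e] at h
    have h1 := I.one_le_clamp i
    obtain ⟨S, hS, hsub⟩ := I.refines (I.clamp i + 1) (by omega) (by omega) _
      (I.part_mem_parts _ y)
    rw [Nat.add_sub_cancel] at hS
    have hy : y ∈ S := hsub (Finpartition.mem_part _ (Finset.mem_univ y))
    have hx : x ∈ S := hsub (I.part_eq_iff_mem.1 h)
    rw [Finpartition.part_eq_of_mem _ hS hx, Finpartition.part_eq_of_mem _ hS hy]

theorem blockRep_eq_of_le {i j : ℕ} (h : i ≤ j) {x y : V} (hxy : I.blockRep j x = I.blockRep j y) :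
    I.blockRep i x = I.blockRep i y := by
  induction h with
  | refl => exact hxy
  | step _ ih => exact ih (I.blockRep_succ _ _ _ hxy)

theorem confined_iff {i : ℕ} {x y : V} :
    I.Confined {x, y} i ↔ (I.H i).part x = (I.H i).part y := by
  constructor
  · rintro ⟨S, hS, hsub⟩
    rw [Finpartition.part_eq_of_mem _ hS (hsub (by simp)),
      Finpartition.part_eq_of_mem _ hS (hsub (by simp))]
  · intro h
    refine ⟨_, I.part_mem_parts _ y, ?_⟩
    intro z hz
    rw [Finset.mem_insert, Finset.mem_singleton] at hz
    rcases hz with rfl | rfl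
    · exact I.part_eq_iff_mem.1 h
    · exact Finpartition.mem_part _ (Finset.mem_univ _)

theorem part_one (v : V) : (I.H 1).part v = Finset.univ := by
  have := I.part_mem_parts 1 v
  rw [I.H_one] at this
  exact Finset.mem_singleton.1 this

theorem part_L (v : V) : (I.H I.L).part v = {v} := by
  have h1 := I.part_mem_parts I.L v
  rw [I.H_L] at h1
  obtain ⟨w, _, hw⟩ := Finset.mem_image.1 h1
  have h2 := Finpartition.mem_part (I.H I.L) (Finset.mem_univ v)
  rw [← hw] at h2 ⊢
  rw [Finset.mem_singleton.1 h2]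

theorem level_mem (x y : V) : 1 ≤ I.level {x, y} ∧ I.level {x, y} ≤ I.L ∧
    (I.H (I.level {x, y})).part x = (I.H (I.level {x, y})).part y := by
  have h := Nat.sSup_mem (s := {l : ℕ | 1 ≤ l ∧ l ≤ I.L ∧ I.Confined {x, y} l})
    ⟨1, le_rfl, I.one_le_L, I.confined_iff.2 (by rw [I.part_one, I.part_one])⟩
    ⟨I.L, fun l hl => hl.2.1⟩
  exact ⟨h.1, h.2.1, I.confined_iff.1 h.2.2⟩

theorem le_level {i : ℕ} {x y : V} (h1 : 1 ≤ i) (h2 : i ≤ I.L)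
    (h : (I.H i).part x = (I.H i).part y) : i ≤ I.level {x, y} :=
  le_csSup ⟨I.L, fun _ hl => hl.2.1⟩ ⟨h1, h2, I.confined_iff.2 h⟩

theorem blockRep_level (x y : V) :
    I.blockRep (I.level {x, y}) x = I.blockRep (I.level {x, y}) y := by
  obtain ⟨h1, h2, h3⟩ := I.level_mem x y
  rwa [I.blockRep_eq_iff, I.clamp_eq h1 h2]

/-- The bound `D i`, replaced by `0` where it is negative. A negative `D i` is never attained as a
cost, and the replacement makes the bounds antitone. -/
def levelBound (i : ℕ) : ℝ := max (I.D (I.clamp i)) 0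

theorem levelBound_anti : Antitone I.levelBound := by
  refine antitone_nat_of_succ_le fun i => ?_
  unfold levelBound
  rcases I.clamp_succ i with e | ⟨e, hL⟩
  · rw [e]
  · rw [e]
    have h := I.two_mul_D_le _ (I.one_le_clamp i) hL
    have h' : 2 * (I.D (I.clamp i + 1) : ℝ) ≤ I.D (I.clamp i) := by exact_mod_cast h
    rcases le_total (I.D (I.clamp i + 1) : ℝ) 0 with h0 | h0
    · rw [max_eq_right h0]; exact le_max_right _ _
    · rw [max_eq_left h0]; exact le_max_of_le_left (by linarith)

theorem levelBound_clamp (i : ℕ) : I.levelBound (I.clamp i) = I.levelBound i := by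
  unfold levelBound
  rw [I.clamp_eq (I.one_le_clamp i) (I.clamp_le i)]

/-- The cost function with the diagonal set to `0`; paths never use the diagonal. -/
def cost (x y : V) : ℝ := if x = y then 0 else I.c x y

theorem cost_self (x : V) : I.cost x x = 0 := if_pos rfl

theorem cost_of_ne {x y : V} (h : x ≠ y) : I.cost x y = I.c x y := if_neg h

theorem cost_nonneg (x y : V) : 0 ≤ I.cost x y := by
  unfold cost
  split_ifs
  · exact le_rfl
  · exact I.c_nonneg x y

theorem cost_le (x y : V) : I.cost x y ≤ I.c x y := by
  unfold cost
  split_ifs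
  · exact I.c_nonneg x y
  · exact le_rfl

theorem cost_triangle (x y z : V) : I.cost x z ≤ I.cost x y + I.cost y z := by
  by_cases h1 : x = y
  · rw [h1, I.cost_self, zero_add]
  by_cases h2 : y = z
  · rw [h2, I.cost_self, add_zero]
  rw [I.cost_of_ne h1, I.cost_of_ne h2]
  exact (I.cost_le x z).trans (I.triangle x y z)

theorem pathHopCost_cost {l : List V} (hl : l.Nodup) :
    pathHopCost I.cost I.k l = pathHopCost I.c I.k l := by
  induction l with
  | nil => simp [pathHopCost_nil]
  | cons x l ih =>
    rw [List.nodup_cons] at hl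
    rw [pathHopCost_cons, pathHopCost_cons, ih hl.2]
    congr 2
    refine List.map_congr_left fun y hy => I.cost_of_ne fun h => hl.1 ?_
    rw [h]
    exact List.mem_of_mem_take hy

theorem cost_le_levelBound (i : ℕ) (x y : V) (h : I.blockRep i x = I.blockRep i y) :
    I.cost x y ≤ I.levelBound i := by
  have hnn : 0 ≤ I.levelBound i := le_max_right _ _
  by_cases hxy : x = y
  · rwa [hxy, I.cost_self]
  rw [I.cost_of_ne hxy]
  obtain ⟨h1, h2, h3⟩ := I.level_mem x y
  have h4 : I.clamp i ≤ I.level {x, y} :=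
    I.le_level (I.one_le_clamp i) (I.clamp_le i) (I.blockRep_eq_iff.1 h)
  have h5 := I.levelBound_anti h4
  rw [I.levelBound_clamp] at h5
  refine le_trans ?_ h5
  rw [levelBound, I.clamp_eq h1 h2]
  refine le_max_of_le_left ?_
  rcases lt_or_gt_of_ne hxy with h | h
  · exact I.cost_forward x y h
  · exact (I.cost_backward x y h).le

theorem levelBound_le_cost (i : ℕ) (x y : V) (hlt : y < x)
    (h : I.blockRep (i + 1) x ≠ I.blockRep (i + 1) y) : I.levelBound i ≤ I.cost x y := by
  obtain ⟨h1, h2, h3⟩ := I.level_mem x y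
  have h4 : I.level {x, y} ≤ i := by
    by_contra hc
    exact h (I.blockRep_eq_of_le (not_le.1 hc) (I.blockRep_level x y))
  refine (I.levelBound_anti h4).trans ?_
  rw [I.cost_of_ne hlt.ne', levelBound, I.clamp_eq h1 h2, ← I.cost_backward x y hlt]
  exact max_le le_rfl (I.c_nonneg x y)

/-- The hierarchy of an instance, timed by a list of its vertices. -/
def timed (hk : 1 ≤ I.k) {l : List V} (hl : l.Nodup) (hmem : ∀ v, v ∈ l) : TimedHierarchy V where
  c := I.cost
  k := I.k
  L := I.L
  rep := I.blockRep
  D := I.levelBound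
  pos := fun v => l.idxOf v
  k_pos := hk
  L_pos := I.one_le_L
  c_nonneg := I.cost_nonneg
  c_self := I.cost_self
  tri := I.cost_triangle
  rep_mono := I.blockRep_mono
  rep_rep := fun i v => I.blockRep_eq_iff.2 (I.part_blockRep i v)
  rep_succ := I.blockRep_succ
  rep_one := fun x y => by
    rw [I.blockRep_eq_iff, I.clamp_eq le_rfl I.one_le_L, I.part_one, I.part_one]
  rep_L := fun x y h => by
    rw [I.blockRep_eq_iff, I.clamp_eq I.one_le_L le_rfl, I.part_L, I.part_L] at h
    exact Finset.singleton_injective h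
  D_nonneg := fun _ => le_max_right _ _
  D_anti := I.levelBound_anti
  c_le := I.cost_le_levelBound
  le_c := I.levelBound_le_cost
  pos_inj := fun x y h => (List.idxOf_inj (hmem x)).1 h
  pos_lt := fun v => by
    have hc : l.length = Fintype.card V := by
      rw [← List.toFinset_card_of_nodup hl, ← Finset.card_univ]
      congr 1
      ext v
      simp [hmem v]
    rw [← hc]
    exact List.idxOf_lt_length_of_mem (hmem v)
  pos_surj := fun t ht => by
    have hc : l.length = Fintype.card V := by
      rw [← List.toFinset_card_of_nodup hl, ← Finset.card_univ]
      congr 1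
      ext v
      simp [hmem v]
    rw [← hc] at ht
    exact ⟨l[t], hl.idxOf_getElem t ht⟩

theorem timed_tourCost (hk : 1 ≤ I.k) {l : List V} (hl : l.Nodup) (hmem : ∀ v, v ∈ l) :
    (I.timed hk hl hmem).tourCost = pathHopCost I.cost I.k l := by
  have hp : l.Pairwise fun x y => l.idxOf x < l.idxOf y := by
    rw [List.pairwise_iff_getElem]
    intro i j hi hj hij
    rwa [hl.idxOf_getElem i hi, hl.idxOf_getElem j hj]
  rw [pathHopCost_eq_setHopCost _ _ _ hp]
  have : l.toFinset = Finset.univ := by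
    ext v
    simp [hmem v]
  rw [this]
  rfl

/-- In a non-degenerate instance some `k + 1` vertices are spread over the blocks of level `2`: take
about half of them from a block with at least `k / 2` vertices and the others outside it, or take
any `k + 1` vertices if there is no such block. -/
theorem exists_spread (hL : 2 ≤ I.L) (hdeg : ¬ I.Degenerate) :
    ∃ W : Finset V, W.card = I.k + 1 ∧ I.k ^ 2 ≤ 2 * ∑ x ∈ W,
      (W.filter fun y => (I.H 2).part x ≠ (I.H 2).part y).card := by
  by_cases hbig : ∃ S ∈ (I.H 2).parts, (I.k + 1) / 2 ≤ S.card
  · obtain ⟨S, hS, hcard⟩ := hbig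
    have hc : I.k / 2 + 1 ≤ Sᶜ.card := by
      by_contra h
      refine hdeg ⟨hL, S, hS, ?_⟩
      have : Sᶜ.card * 2 ≤ I.k := by omega
      have : (Sᶜ.card : ℝ) * 2 ≤ I.k := by exact_mod_cast this
      linarith
    obtain ⟨A, hAS, hA⟩ := Finset.exists_subset_card_eq hcard
    obtain ⟨B, hBS, hB⟩ := Finset.exists_subset_card_eq hc
    have hdisj : Disjoint A B := Finset.disjoint_left.2 fun x hx hx' =>
      Finset.mem_compl.1 (hBS hx') (hAS hx)
    have hne : ∀ a ∈ A, ∀ b ∈ B, (I.H 2).part a ≠ (I.H 2).part b := by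
      intro a ha b hb h
      refine Finset.mem_compl.1 (hBS hb) ?_
      rw [← Finpartition.part_eq_of_mem _ hS (hAS ha), h]
      exact Finpartition.mem_part _ (Finset.mem_univ b)
    refine ⟨A ∪ B, by rw [Finset.card_union_of_disjoint hdisj]; omega, ?_⟩
    rw [Finset.sum_union hdisj]
    have h1 : A.card * B.card ≤ ∑ x ∈ A,
        ((A ∪ B).filter fun y => (I.H 2).part x ≠ (I.H 2).part y).card := by
      rw [← smul_eq_mul]
      refine Finset.card_nsmul_le_sum _ _ _ fun a ha => Finset.card_le_card fun b hb => ?_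
      exact Finset.mem_filter.2 ⟨Finset.mem_union_right _ hb, hne a ha b hb⟩
    have h2 : B.card * A.card ≤ ∑ x ∈ B,
        ((A ∪ B).filter fun y => (I.H 2).part x ≠ (I.H 2).part y).card := by
      rw [← smul_eq_mul]
      refine Finset.card_nsmul_le_sum _ _ _ fun b hb => Finset.card_le_card fun a ha => ?_
      exact Finset.mem_filter.2 ⟨Finset.mem_union_left _ ha, (hne a ha b hb).symm⟩
    have h3 : I.k ≤ 2 * A.card := by omega
    have h4 : I.k ≤ 2 * B.card := by omega
    nlinarith [Nat.mul_le_mul h3 h4]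
  · push Not at hbig
    obtain ⟨W, _, hW⟩ := Finset.exists_subset_card_eq
      (show I.k + 1 ≤ (Finset.univ : Finset V).card from I.k_lt_card)
    refine ⟨W, hW, ?_⟩
    have h1 : W.card * (I.k / 2 + 1) ≤
        ∑ x ∈ W, (W.filter fun y => (I.H 2).part x ≠ (I.H 2).part y).card := by
      rw [← smul_eq_mul]
      refine Finset.card_nsmul_le_sum _ _ _ fun x _ => ?_
      have h2 := Finset.card_filter_add_card_filter_not (s := W)
        (fun y => (I.H 2).part x = (I.H 2).part y)
      have h3 : (W.filter fun y => (I.H 2).part x = (I.H 2).part y).card ≤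
          ((I.H 2).part x).card := by
        refine Finset.card_le_card fun y hy => ?_
        exact I.part_eq_iff_mem.1 (Finset.mem_filter.1 hy).2.symm
      have h4 := hbig _ (I.part_mem_parts _ x)
      simp only [ne_eq]
      omega
    have h5 : I.k ≤ 2 * (I.k / 2 + 1) := by omega
    rw [hW] at h1
    nlinarith

/-- Non-degeneracy makes every tour pay for a path of level `1`. Restricted to `k + 1` spread
vertices, the tour taken twice pays for all their ordered pairs. -/
theorem sq_mul_levelBound_one_le (hL : 2 ≤ I.L) (hdeg : ¬ I.Degenerate) {T : List V}
    (hT : IsTour T) : (I.k : ℝ) ^ 2 * I.levelBound 1 ≤ 8 * tourHopCost I.cost I.k T := by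
  obtain ⟨W, hW, hcount⟩ := I.exists_spread hL hdeg
  set w := T.dedup.filter (· ∈ W) with hw
  have hnd : w.Nodup := (List.nodup_dedup T).filter _
  have hwW : w.toFinset = W := by
    ext x
    simp [hw, hT.2 x]
  have hlen : w.length = I.k + 1 := by rw [← List.toFinset_card_of_nodup hnd, hwW, hW]
  have hsub : w.Sublist T := List.filter_sublist.trans (List.dedup_sublist T)
  have h1 := sum_le_pathHopCost_append_self I.cost_nonneg I.cost_self I.k w hlen
  have h2 := pathHopCost_sublist I.cost_triangle I.cost_nonneg I.k (hsub.append hsub)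
  have h3 := pathHopCost_append_self_le I.cost_nonneg I.k T
  have h4 : (w.map fun x => (w.map (I.cost x)).sum).sum = ∑ x ∈ W, ∑ y ∈ W, I.cost x y := by
    rw [← hwW, List.sum_toFinset _ hnd]
    refine congrArg List.sum (List.map_congr_left fun x _ => ?_)
    rw [List.sum_toFinset _ hnd]
  -- of two vertices in different blocks of level 2, one follows the other in the given order
  have h5 : ∑ x ∈ W, ((W.filter fun y => (I.H 2).part x ≠ (I.H 2).part y).card : ℝ) *
      I.levelBound 1 ≤ ∑ x ∈ W, ∑ y ∈ W, (I.cost x y + I.cost y x) := by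
    refine Finset.sum_le_sum fun x _ => ?_
    rw [← nsmul_eq_mul]
    refine (Finset.card_nsmul_le_sum _ (fun y => I.cost x y + I.cost y x) _ fun y hy => ?_).trans
      (Finset.sum_le_sum_of_subset_of_nonneg (Finset.filter_subset _ _) fun y _ _ =>
        add_nonneg (I.cost_nonneg _ _) (I.cost_nonneg _ _))
    have hne : I.blockRep (1 + 1) x ≠ I.blockRep (1 + 1) y := by
      rw [Ne, I.blockRep_eq_iff, I.clamp_eq (by omega) hL]
      exact (Finset.mem_filter.1 hy).2
    have hxy : x ≠ y := fun h => hne (by rw [h])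
    have := I.cost_nonneg x y
    have := I.cost_nonneg y x
    rcases lt_or_gt_of_ne hxy with h | h
    · linarith [I.levelBound_le_cost 1 y x h hne.symm]
    · linarith [I.levelBound_le_cost 1 x y h hne]
  have h6 : ∑ x ∈ W, ∑ y ∈ W, (I.cost x y + I.cost y x) = 2 * ∑ x ∈ W, ∑ y ∈ W, I.cost x y := by
    simp only [Finset.sum_add_distrib]
    nth_rw 2 [Finset.sum_comm]
    ring
  have h7 : (I.k : ℝ) ^ 2 ≤ 2 * ∑ x ∈ W,
      ((W.filter fun y => (I.H 2).part x ≠ (I.H 2).part y).card : ℝ) := by exact_mod_cast hcount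
  have h8 := mul_le_mul_of_nonneg_right h7 (show 0 ≤ I.levelBound 1 from le_max_right _ _)
  rw [← Finset.sum_mul] at h5
  linarith

theorem two_le_L (hk : 1 ≤ I.k) : 2 ≤ I.L := by
  by_contra hc
  have h1 : I.L = 1 := by have := I.one_le_L; omega
  have hcard := I.k_lt_card
  obtain ⟨v⟩ : Nonempty V := Fintype.card_pos_iff.1 (by omega)
  have h2 := I.part_L v
  rw [h1, I.part_one] at h2
  have h3 := congrArg Finset.card h2
  rw [Finset.card_univ, Finset.card_singleton] at h3
  omega

/-- For `k = 0` all weights vanish and single vertices do. -/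
theorem exists_pathCovering_of_k_eq_zero (hk : I.k = 0) (T : List V) :
    ∃ Ps, I.IsPathCovering Ps ∧ I.weight Ps ≤ 802 * (I.L : ℝ) ^ 3 * tourHopCost I.c I.k T := by
  refine ⟨Finset.univ.image fun v => ([v], 1), ⟨?_, ?_, ?_⟩, ?_⟩
  · intro p hp
    obtain ⟨v, _, rfl⟩ := Finset.mem_image.1 hp
    exact ⟨⟨⟨by simp, by simp⟩, by simp⟩, ⟨le_rfl, I.one_le_L⟩, Finset.univ, by simp [I.H_one],
      by simp⟩
  · exact fun v => ⟨([v], 1), Finset.mem_image_of_mem _ (Finset.mem_univ v), by simp⟩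
  · exact fun l hl _ S _ => Or.inl fun v _ => ⟨([v], 1),
      Finset.mem_image_of_mem _ (Finset.mem_univ v), by dsimp only; omega, by simp⟩
  · simp [weight, pathHopCost, tourHopCost, hk]

theorem exists_pathCovering (hk : 1 ≤ I.k) (hdeg : ¬ I.Degenerate) {T : List V} (hT : IsTour T) :
    ∃ Ps, I.IsPathCovering Ps ∧ I.weight Ps ≤ 802 * (I.L : ℝ) ^ 3 * tourHopCost I.c I.k T := by
  classical
  have hL := I.two_le_L hk
  set J := I.timed hk (List.nodup_dedup T) (fun v => List.mem_dedup.2 (hT.2 v)) with hJ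
  have hrep : ∀ {i : ℕ}, 1 ≤ i → i ≤ I.L → ∀ {x y : V},
      J.rep i x = J.rep i y ↔ x ∈ (I.H i).part y := by
    intro i h1 h2 x y
    have := I.blockRep_eq_iff (i := i) (x := x) (y := y)
    rw [I.clamp_eq h1 h2, I.part_eq_iff_mem] at this
    exact this
  have hmem : ∀ x v, x ∈ J.pathList (J.key v) ↔ J.key x = J.key v := by
    intro x v
    rw [TimedHierarchy.pathList, Finset.mem_sort, Finset.mem_filter]
    simp
  have htoF : ∀ v, (J.pathList (J.key v)).toFinset = J.pathSet v := fun v =>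
    Finset.sort_toFinset _ _
  set f : ℕ × ℕ × V × ℕ → List V × ℕ := fun κ => (J.pathList κ, κ.1) with hf
  set Ps := (Finset.univ.image J.key).image f with hPs
  have hin : ∀ v, (J.pathList (J.key v), J.pathLevel v) ∈ Ps := fun v =>
    Finset.mem_image.2 ⟨J.key v, Finset.mem_image_of_mem _ (Finset.mem_univ v), rfl⟩
  have hpair : ∀ p ∈ Ps, I.IsPathLevelPair p := by
    intro p hp
    obtain ⟨κ, hκ, rfl⟩ := Finset.mem_image.1 hp
    obtain ⟨v, _, rfl⟩ := Finset.mem_image.1 hκ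
    have h1 := J.one_le_pathLevel v
    have h2 : J.pathLevel v ≤ I.L := J.pathLevel_le v
    refine ⟨⟨⟨List.ne_nil_of_mem ((hmem v v).2 rfl), Finset.sort_nodup _ _⟩,
      ((Finset.sortedLT_sort _).pairwise).isChain⟩, ⟨h1, h2⟩, (I.H (J.pathLevel v)).part v,
      I.part_mem_parts _ v, ?_⟩
    intro x hx
    have hx' : J.key x = J.key v := (hmem x v).1 (List.mem_toFinset.1 hx)
    have e1 : J.pathLevel x = J.pathLevel v := congrArg (·.1) hx'
    have e2 : J.rep (J.pathLevel x) x = J.rep (J.pathLevel v) v := congrArg (·.2.2.1) hx'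
    rw [e1] at e2
    exact (hrep h1 h2).1 e2
  refine ⟨Ps, ⟨hpair, fun v => ⟨_, hin v, (hmem v v).2 rfl⟩, ?_⟩, ?_⟩
  · intro l hl1 hl2 S hS
    obtain ⟨v₀, hv₀⟩ := (I.H l).nonempty_of_mem_parts hS
    have hS' : ∀ v, J.rep l v = J.rep l v₀ ↔ v ∈ S := by
      intro v
      rw [hrep (by omega) hl2, Finpartition.part_eq_of_mem _ hS hv₀]
    rcases J.covered_or_exists_long_path hl1 v₀ with h | ⟨x, hx, hcard⟩
    · exact Or.inl fun v hv => ⟨_, hin v, h v ((hS' v).2 hv), (hmem v v).2 rfl⟩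
    · refine Or.inr ⟨_, hin x, hx, hcard.trans (Finset.card_le_card fun u hu => ?_)⟩
      rw [htoF, Finset.mem_inter]
      exact ⟨(Finset.mem_filter.1 hu).1, (hS' u).1 (Finset.mem_filter.1 hu).2⟩
  · set g : List V × ℕ → ℝ := fun p => pathHopCost J.c J.k p.1 + (J.k : ℝ) ^ 2 * J.D p.2 with hg
    have hgnn : ∀ p, 0 ≤ g p := fun p => add_nonneg
      (Finset.sum_nonneg fun _ _ => Finset.sum_nonneg fun _ _ => by
        split_ifs
        · exact J.c_nonneg _ _
        · exact le_rfl) (mul_nonneg (sq_nonneg _) (J.D_nonneg _))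
    have h1 : I.weight Ps ≤ ∑ p ∈ Ps, g p := by
      refine Finset.sum_le_sum fun p hp => ?_
      obtain ⟨⟨⟨_, hnd⟩, _⟩, ⟨hp1, hp2⟩, _⟩ := hpair p hp
      refine add_le_add (I.pathHopCost_cost hnd).symm.le
        (mul_le_mul_of_nonneg_left ?_ (sq_nonneg _))
      change (I.D p.2 : ℝ) ≤ I.levelBound p.2
      rw [levelBound, I.clamp_eq hp1 hp2]
      exact le_max_left _ _
    have h2 : ∑ p ∈ Ps, g p ≤ ∑ κ ∈ Finset.univ.image J.key, g (f κ) :=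
      Finset.sum_image_le_of_nonneg fun _ _ => hgnn _
    have h3 := J.sum_weight_le
    have h4 : J.tourCost ≤ 2 * tourHopCost I.cost I.k T := by
      rw [hJ, I.timed_tourCost]
      exact (pathHopCost_sublist I.cost_triangle I.cost_nonneg I.k ((List.dedup_sublist T).trans
        (List.sublist_append_left T T))).trans (pathHopCost_append_self_le I.cost_nonneg I.k T)
    have h5 := I.sq_mul_levelBound_one_le hL hdeg hT
    have h6 : tourHopCost I.cost I.k T ≤ tourHopCost I.c I.k T :=
      Finset.sum_le_sum fun _ _ => Finset.sum_le_sum fun _ _ => I.cost_le _ _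
    have h7 : 0 ≤ tourHopCost I.cost I.k T :=
      Finset.sum_nonneg fun _ _ => Finset.sum_nonneg fun _ _ => I.cost_nonneg _ _
    have hL1 : (1 : ℝ) ≤ I.L := by exact_mod_cast I.one_le_L
    have hL3 : (I.L : ℝ) ≤ (I.L : ℝ) ^ 3 := le_self_pow₀ hL1 (by norm_num)
    have h8 : (I.L : ℝ) * ((I.k : ℝ) ^ 2 * I.levelBound 1) ≤
        (I.L : ℝ) ^ 3 * (8 * tourHopCost I.c I.k T) := by
      refine mul_le_mul hL3 (h5.trans (by linarith)) ?_ (by positivity)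
      exact mul_nonneg (sq_nonneg _) (le_max_right _ _)
    have h9 : 393 * (I.L : ℝ) ^ 3 * J.tourCost ≤
        393 * (I.L : ℝ) ^ 3 * (2 * tourHopCost I.c I.k T) :=
      mul_le_mul_of_nonneg_left (by linarith) (by positivity)
    have h10 : I.weight Ps ≤ 393 * (I.L : ℝ) ^ 3 * J.tourCost +
        I.L * ((I.k : ℝ) ^ 2 * I.levelBound 1) := h1.trans (h2.trans h3)
    have h11 : 0 ≤ (I.L : ℝ) ^ 3 * tourHopCost I.c I.k T :=
      mul_nonneg (by positivity) (h7.trans h6)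
    linarith

end HierOrderedInstance

theorem mainTheorem8 :
    ∃ C : ℝ, 0 < C ∧
      ∀ (V : Type*) [Fintype V] [LinearOrder V] (I : HierOrderedInstance V), ¬ I.Degenerate →
        ∀ T : List V, IsTour T →
          ∃ Ps : Finset (List V × ℕ), I.IsPathCovering Ps ∧
            I.weight Ps ≤ C * (I.L : ℝ) ^ 3 * tourHopCost I.c I.k T := by
  refine ⟨802, by norm_num, fun V _ _ I hdeg T hT => ?_⟩
  rcases Nat.eq_zero_or_pos I.k with hk | hk
  · exact I.exists_pathCovering_of_k_eq_zero hk T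
  · exact I.exists_pathCovering hk hdeg hT
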